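/- Let $0<|q|<1$, fix a square root $q^{1/2}$ of $q$, and put $q^{m/2}=(q^{1/2})^m$ for $m\in\mathbb Z$. Write $(x;q)_\infty=\prod_{n\ge 0}(1-xq^n)$ and $(x_1,\dots,x_r;q)_\infty=(x_1;q)_\infty\cdots(x_r;q)_\infty$. Let $a_1,a_2,a_3,b_1,b_2,b_3$ be complex numbers with $a_1a_2a_3=b_1b_2b_3=q^{1/2}$ that are generic, in the sense that no product $a_jb_k$ and no quotient $a_j/a_k$ or $b_j/b_k$ with $j\ne k$ is an integer power of $q$, and let $M_j,N_j$ ($j=1,2,3$) be integers with $M_1+M_2+M_3=N_1+N_2+N_3=0$. Then $$\sum_{m=-\infty}^\infty\oint\prod_{j=1}^3\frac{(q^{1+m/2}/a_jz,\,q^{1-m/2}z/b_j;q)_\infty}{(q^{M_j+m/2}a_jz,\,q^{N_j-m/2}b_j/z;q)_\infty}\,\frac{(-1)^m}{z^{3m}}\,\frac{dz}{2\pi\mathrm i z}=\frac{1}{\prod_{j=1}^3q^{\binom{M_j}2+\binom{N_j}2}a_j^{M_j}b_j^{N_j}}\prod_{j,k=1}^3\frac{(q/a_jb_k;q)_\infty}{(a_jb_kq^{M_j+N_k};q)_\infty},$$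 where the sum over $m$ converges absolutely and, for each $m$, the integral is over any positively oriented closed contour (piecewise $C^1$) in $\mathbb C\setminus\{0\}$ separating the poles of the integrand that form geometric sequences converging to $0$, namely $z=q^{N_j-m/2+k}b_j$ with $k\ge\max(0,m-N_j)$, from those converging to $\infty$, namely $z=q^{-M_j-m/2-k}/a_j$ with $k\ge\max(0,-m-M_j)$; that is, it passes through none of these points, and it has winding number $1$ around $0$ and around the former poles and winding number $0$ around the latter. -/

import Mathlib

noncomputable section

namespace SQED

/-- The infinite `q`-shifted factorial `(x; q)_∞ = ∏_{n ≥ 0} (1 - x q^n)`, for `|q| < 1`. -/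
def qPoch (x q : ℂ) : ℂ := ∏' n : ℕ, (1 - x * q ^ n)

/-- The contour integral `∫_γ f(z) dz` of a complex function along a path in `ℂ`. -/
def contourIntegral (f : ℂ → ℂ) {x y : ℂ} (γ : Path x y) : ℂ :=
  curveIntegral (fun z => ContinuousLinearMap.toSpanSingleton ℂ (f z)) γ

/-- A path is piecewise `C^1`: there are finitely many break points such that the path is `C^1` on
every closed subinterval of `[0, 1]` without break points in its interior. -/
def IsPiecewiseC1 {x y : ℂ} (γ : Path x y) : Prop :=
  ∃ P : Finset ℝ, ∀ c d : ℝ, 0 ≤ c → c < d → d ≤ 1 → Disjoint (Set.Ioo c d) (P : Set ℝ) →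
    ContDiffOn ℝ 1 γ.extend (Set.Icc c d)

/-- The winding number `(2πi)⁻¹ ∮_γ dz / (z - w)` of a closed path around a point `w` off it. -/
def windingNumber {x : ℂ} (γ : Path x x) (w : ℂ) : ℂ :=
  (2 * Real.pi * Complex.I)⁻¹ * contourIntegral (fun z => (z - w)⁻¹) γ

/-- The closed path `γ` is a positively oriented contour that separates the points of `S` (and the
origin), which it encircles once, from the points of `T`, which lie outside of it. -/
structure IsSeparatingContour {x : ℂ} (γ : Path x x) (S T : Set ℂ) : Prop where
  piecewiseC1 : IsPiecewiseC1 γ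
  inside : ∀ w ∈ insert 0 S, w ∉ Set.range γ ∧ windingNumber γ w = 1
  outside : ∀ w ∈ T, w ∉ Set.range γ ∧ windingNumber γ w = 0

/-- The function `∏_j (q^{1+m/2}/(a_j z), q^{1-m/2} z/b_j; q)_∞ /
(q^{M_j+m/2} a_j z, q^{N_j-m/2} b_j/z; q)_∞ · (-1)^m z^{-3m}`,
where `r` is the chosen square root of `q`, so that `q^{m/2} = r^m`. -/
def integrand (q r : ℂ) (a b : Fin 3 → ℂ) (M N : Fin 3 → ℤ) (m : ℤ) (z : ℂ) : ℂ :=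
  (∏ j, qPoch (q * r ^ m / (a j * z)) q * qPoch (q * r ^ (-m) * z / b j) q /
      (qPoch (q ^ M j * r ^ m * a j * z) q * qPoch (q ^ N j * r ^ (-m) * b j / z) q)) *
    ((-1) ^ m * z ^ (-3 * m))

/-- The poles of the integrand in geometric sequences converging to `0`: the zeros
`z = q^{N_j - m/2 + k} b_j`, `k ≥ 0`, of `(q^{N_j-m/2} b_j/z; q)_∞`, except those with
`k < m - N_j`, which are cancelled by zeros of `(q^{1-m/2} z/b_j; q)_∞`. -/
def polesToZero (q r : ℂ) (b : Fin 3 → ℂ) (N : Fin 3 → ℤ) (m : ℤ) : Set ℂ :=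
  {z | ∃ (j : Fin 3) (k : ℤ), 0 ≤ k ∧ m - N j ≤ k ∧ z = q ^ (N j + k) * r ^ (-m) * b j}

/-- The poles of the integrand in geometric sequences converging to `∞`: the zeros
`z = 1 / (q^{M_j + m/2 + k} a_j)`, `k ≥ 0`, of `(q^{M_j+m/2} a_j z; q)_∞`, except those with
`k < -m - M_j`, which are cancelled by zeros of `(q^{1+m/2}/(a_j z); q)_∞`. -/
def polesToInfinity (q r : ℂ) (a : Fin 3 → ℂ) (M : Fin 3 → ℤ) (m : ℤ) : Set ℂ :=
  {z | ∃ (j : Fin 3) (k : ℤ), 0 ≤ k ∧ -m - M j ≤ k ∧ z = (q ^ (M j + k) * r ^ m * a j)⁻¹}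

/-- Genericity of the parameters: no product `a_j b_k`, and no quotient `a_j / a_k` or `b_j / b_k`
with `j ≠ k`, is an integer power of `q`. -/
structure IsGeneric (q : ℂ) (a b : Fin 3 → ℂ) : Prop where
  mul_ne : ∀ (j k : Fin 3) (n : ℤ), a j * b k ≠ q ^ n
  left_ne : ∀ (j k : Fin 3) (n : ℤ), j ≠ k → a j ≠ q ^ n * a k
  right_ne : ∀ (j k : Fin 3) (n : ℤ), j ≠ k → b j ≠ q ^ n * b k

end SQED

end

/-!
Moving the contour towards the origin collects the residues at the poles that tend to `0`; the
integrals over the small circles tend to `0`, because `z ↦ q z` multiplies the integrand by a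
function that tends to `q ^ 2` at `z = 0`. By the quasi-periodicity of the theta function
`(x, q / x; q)_∞`, the residue at `z = q^{N_j - m/2 + s} b_j` is a constant times the term of index
`s - m + N_j` of a balanced `₃φ₂` series times the term of index `s` of the same series for the
parameters `q^{M_i} a_i`, `q^{N_i} b_i`. The shear `(m, s) ↦ (s - m + N_j, s)` therefore turns the
double sum over `m` and `s` into a product `f_j g_j` of two such series. The nonterminating
`q`-Saalschütz summation gives `f_j - f_{j+1} = c u_j` and `g_j - g_{j+1} = d u_j`, where the `u_j`
are products of theta functions. Since the residue constants are proportional to `u_{j+1}`, it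
remains to observe that these relations imply `∑ j, u_{j+1} f_j g_j = -c d u_0 u_1 u_2`.
-/

noncomputable section

namespace SQED

section QPochhammer

open Filter Topology Finset

variable {q : ℂ}

/-- The finite `q`-shifted factorial `(x; q)_n`. -/
def qFac (x q : ℂ) (n : ℕ) : ℂ := ∏ i ∈ range n, (1 - x * q ^ i)

theorem qFac_zero (x q : ℂ) : qFac x q 0 = 1 := by simp [qFac]

theorem qFac_succ (x q : ℂ) (n : ℕ) : qFac x q (n + 1) = qFac x q n * (1 - x * q ^ n) := by
  simp [qFac, prod_range_succ]

theorem qFac_succ' (x q : ℂ) (n : ℕ) : qFac x q (n + 1) = (1 - x) * qFac (q * x) q n := by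
  simp only [qFac, prod_range_succ', pow_zero, mul_one]
  rw [mul_comm]
  congr 1
  exact prod_congr rfl fun i _ => by ring

theorem summable_mul_pow (hq : ‖q‖ < 1) (x : ℂ) : Summable fun n : ℕ => ‖-(x * q ^ n)‖ := by
  simp only [norm_neg, norm_mul, norm_pow]
  exact (summable_geometric_of_lt_one (norm_nonneg q) hq).mul_left _

theorem multipliable_qPoch (hq : ‖q‖ < 1) (x : ℂ) : Multipliable fun n : ℕ => 1 - x * q ^ n := by
  simpa only [sub_eq_add_neg] using multipliable_one_add_of_summable (summable_mul_pow hq x)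

theorem tendsto_qFac (hq : ‖q‖ < 1) (x : ℂ) :
    Tendsto (qFac x q) atTop (𝓝 (qPoch x q)) :=
  (multipliable_qPoch hq x).hasProd.tendsto_prod_nat

theorem qPoch_eq_one_sub_mul (hq : ‖q‖ < 1) (x : ℂ) :
    qPoch x q = (1 - x) * qPoch (q * x) q := by
  have h1 : Tendsto (fun n => qFac x q (n + 1)) atTop (𝓝 (qPoch x q)) :=
    (tendsto_qFac hq x).comp (tendsto_add_atTop_nat 1)
  refine tendsto_nhds_unique h1 ?_
  simp only [qFac_succ']
  exact (tendsto_qFac hq (q * x)).const_mul _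

theorem qPoch_eq_qFac_mul (hq : ‖q‖ < 1) (x : ℂ) (n : ℕ) :
    qPoch x q = qFac x q n * qPoch (x * q ^ n) q := by
  induction n with
  | zero => simp [qFac_zero]
  | succ n ih =>
    rw [ih, qPoch_eq_one_sub_mul hq (x * q ^ n), qFac_succ]
    ring_nf

theorem qPoch_ne_zero (hq : ‖q‖ < 1) {x : ℂ} (hx : ∀ n : ℕ, x * q ^ n ≠ 1) : qPoch x q ≠ 0 := by
  have := tprod_one_add_ne_zero_of_summable (f := fun n : ℕ => -(x * q ^ n))
    (fun n h => hx n (by linear_combination -h)) (summable_mul_pow hq x)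
  simpa only [sub_eq_add_neg] using! this

theorem qPoch_self_ne_zero (hq : ‖q‖ < 1) : qPoch q q ≠ 0 := qPoch_ne_zero hq fun n hn => by
  have h : ‖q * q ^ n‖ < 1 := by
    rw [norm_mul, norm_pow]
    exact mul_lt_one_of_nonneg_of_lt_one_left (norm_nonneg _) hq
      (pow_le_one₀ (norm_nonneg _) hq.le)
  rw [hn, norm_one] at h
  exact lt_irrefl _ h

theorem qPoch_eq_zero (hq : ‖q‖ < 1) {x : ℂ} {n : ℕ} (hx : x * q ^ n = 1) : qPoch x q = 0 := by
  rw [qPoch_eq_qFac_mul hq x (n + 1), qFac_succ, hx]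
  simp

@[simp] theorem qPoch_zero (q : ℂ) : qPoch 0 q = 1 := by simp [qPoch]

theorem differentiable_qPoch (hq : ‖q‖ < 1) : Differentiable ℂ fun x => qPoch x q := by
  intro x
  have hK : IsOpen (Metric.ball (0 : ℂ) (‖x‖ + 1)) := Metric.isOpen_ball
  have h := Summable.hasProdLocallyUniformlyOn_nat_one_add (R := ℂ)
    (f := fun (n : ℕ) (x : ℂ) => -(x * q ^ n)) hK (u := fun n => (‖x‖ + 1) * ‖q‖ ^ n)
    ((summable_geometric_of_lt_one (norm_nonneg q) hq).mul_left _)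
    (Eventually.of_forall fun n y hy => by
      rw [norm_neg, norm_mul, norm_pow]
      gcongr
      exact (mem_ball_zero_iff.1 hy).le)
    (fun n => by fun_prop)
  have h2 : DifferentiableOn ℂ (fun x => ∏' n : ℕ, (1 + -(x * q ^ n)))
      (Metric.ball 0 (‖x‖ + 1)) := by
    refine TendstoLocallyUniformlyOn.differentiableOn h (Eventually.of_forall fun s => ?_) hK
    fun_prop
  have h3 := (h2 x (by simp)).differentiableAt (hK.mem_nhds (by simp))
  simpa only [qPoch, sub_eq_add_neg] using h3

theorem continuous_qPoch (hq : ‖q‖ < 1) : Continuous fun x => qPoch x q :=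
  (differentiable_qPoch hq).continuous

theorem tendsto_mul_pow (hq : ‖q‖ < 1) (x : ℂ) : Tendsto (fun n : ℕ => x * q ^ n) atTop (𝓝 0) := by
  simpa using (tendsto_pow_atTop_nhds_zero_of_norm_lt_one hq).const_mul x

theorem tendsto_qPoch_mul_pow (hq : ‖q‖ < 1) (x : ℂ) :
    Tendsto (fun n : ℕ => qPoch (x * q ^ n) q) atTop (𝓝 1) := by
  simpa [Function.comp_def] using ((continuous_qPoch hq).tendsto 0).comp (tendsto_mul_pow hq x)

/-- A bound for `(x; q)_n` that is uniform in `n`. -/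
def qBound (t : ℝ) (q : ℂ) : ℝ := Real.exp (t * (1 - ‖q‖)⁻¹)

theorem norm_qFac_le (hq : ‖q‖ < 1) {x : ℂ} {t : ℝ} (hx : ‖x‖ ≤ t) (n : ℕ) :
    ‖qFac x q n‖ ≤ qBound t q := by
  calc ‖qFac x q n‖ ≤ ∏ i ∈ range n, Real.exp (t * ‖q‖ ^ i) := by
        rw [qFac, norm_prod]
        refine prod_le_prod (fun _ _ => norm_nonneg _) fun i _ => ?_
        calc ‖1 - x * q ^ i‖ ≤ ‖(1 : ℂ)‖ + ‖x * q ^ i‖ := norm_sub_le _ _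
          _ ≤ t * ‖q‖ ^ i + 1 := by
            rw [norm_one, norm_mul, norm_pow, add_comm]
            gcongr
          _ ≤ _ := Real.add_one_le_exp _
    _ = Real.exp (∑ i ∈ range n, t * ‖q‖ ^ i) := (Real.exp_sum _ _).symm
    _ ≤ qBound t q := by
      rw [qBound, ← Finset.mul_sum]
      gcongr
      · exact (norm_nonneg x).trans hx
      · rw [← tsum_geometric_of_lt_one (norm_nonneg q) hq]
        exact (summable_geometric_of_lt_one (norm_nonneg q) hq).sum_le_tsum _
          fun _ _ => by positivity

theorem norm_qPoch_le (hq : ‖q‖ < 1) {x : ℂ} {t : ℝ} (hx : ‖x‖ ≤ t) : ‖qPoch x q‖ ≤ qBound t q :=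
  le_of_tendsto (tendsto_qFac hq x).norm (Eventually.of_forall (norm_qFac_le hq hx))

/-- The theta function `(x, q / x; q)_∞`. -/
def theta (q x : ℂ) : ℂ := qPoch x q * qPoch (q / x) q

theorem theta_mul_q (hq : ‖q‖ < 1) (hq0 : q ≠ 0) {x : ℂ} (hx : x ≠ 0) :
    theta q (q * x) = -x⁻¹ * theta q x := by
  rw [theta, theta, qPoch_eq_one_sub_mul hq x]
  rw [show q / (q * x) = x⁻¹ by field_simp, qPoch_eq_one_sub_mul hq x⁻¹,
    show q * x⁻¹ = q / x by ring]
  field_simp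
  ring

theorem theta_inv (hq : ‖q‖ < 1) {x : ℂ} (hx : x ≠ 0) :
    theta q x⁻¹ = -x⁻¹ * theta q x := by
  rw [theta, theta, qPoch_eq_one_sub_mul hq x, qPoch_eq_one_sub_mul hq x⁻¹]
  simp only [div_eq_mul_inv]
  field_simp
  ring

/-- The factor of automorphy of the theta function: `theta q (q^n x)` is `theta q x` times this
factor, where `r` is a square root of `q`. -/
def thetaFactor (r x : ℂ) (n : ℤ) : ℂ := (-1) ^ n * x ^ (-n) * r ^ (n - n ^ 2)

theorem thetaFactor_ne_zero {r x : ℂ} (hr0 : r ≠ 0) (hx : x ≠ 0) (n : ℤ) :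
    thetaFactor r x n ≠ 0 :=
  mul_ne_zero (mul_ne_zero (zpow_ne_zero _ (by norm_num)) (zpow_ne_zero _ hx)) (zpow_ne_zero _ hr0)

theorem thetaFactor_add_one {r x : ℂ} (hr0 : r ≠ 0) (hx : x ≠ 0) (n : ℤ) :
    thetaFactor r x (n + 1) = -((r ^ 2) ^ n * x)⁻¹ * thetaFactor r x n := by
  rw [thetaFactor, thetaFactor, show (n + 1) - (n + 1) ^ 2 = (n - n ^ 2) + -(2 * n) by ring,
    neg_add, zpow_add₀ hr0, zpow_add₀ hx, zpow_add₀ (by norm_num : (-1 : ℂ) ≠ 0), zpow_neg r,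
    zpow_mul]
  norm_cast
  push_cast
  simp only [zpow_neg, zpow_one, mul_inv]
  ring

theorem theta_zpow_mul {r : ℂ} (hq : ‖q‖ < 1) (hr0 : r ≠ 0) (hr : r ^ 2 = q) (n : ℤ) {x : ℂ}
    (hx : x ≠ 0) : theta q (q ^ n * x) = thetaFactor r x n * theta q x := by
  have hq0 : q ≠ 0 := by rw [← hr]; positivity
  have step : ∀ n : ℤ, theta q (q ^ (n + 1) * x) = -(q ^ n * x)⁻¹ * theta q (q ^ n * x) := by
    intro n
    rw [← theta_mul_q hq hq0 (by positivity), zpow_add_one₀ hq0]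
    ring_nf
  have step' : ∀ n : ℤ, thetaFactor r x (n + 1) = -(q ^ n * x)⁻¹ * thetaFactor r x n :=
    fun n => hr ▸ thetaFactor_add_one hr0 hx n
  induction n using Int.induction_on with
  | zero => simp [thetaFactor]
  | succ n ih => rw [step, ih, step', mul_assoc]
  | pred n ih =>
    have h1 := step (-(n : ℤ) - 1)
    have h2 := step' (-(n : ℤ) - 1)
    rw [sub_add_cancel] at h1 h2
    rw [ih, h2, mul_assoc] at h1
    have h3 : -(q ^ (-(n : ℤ) - 1) * x)⁻¹ ≠ 0 := by
      rw [neg_ne_zero]; positivity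
    exact (mul_left_cancel₀ h3 h1).symm

end QPochhammer

section ContourIntegral

open Filter Topology MeasureTheory Set

theorem contourIntegral_eq (f : ℂ → ℂ) {x y : ℂ} (γ : Path x y) :
    contourIntegral f γ = ∫ t in (0 : ℝ)..1, deriv γ.extend t * f (γ.extend t) := by
  rw [contourIntegral, curveIntegral_eq_intervalIntegral_deriv]
  simp [ContinuousLinearMap.toSpanSingleton_apply]

theorem two_pi_I_mul_windingNumber {x : ℂ} (γ : Path x x) (p : ℂ) :
    2 * Real.pi * Complex.I * windingNumber γ p =
      ∫ t in (0 : ℝ)..1, deriv γ.extend t * (γ.extend t - p)⁻¹ := by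
  rw [windingNumber, contourIntegral_eq, mul_inv_cancel_left₀ Complex.two_pi_I_ne_zero]

theorem IsPiecewiseC1.exists_countable_contDiffAt {x y : ℂ} {γ : Path x y}
    (h : IsPiecewiseC1 γ) :
    ∃ s : Set ℝ, s.Countable ∧ ∀ t ∈ Ioo (0 : ℝ) 1 \ s, ContDiffAt ℝ 1 γ.extend t := by
  obtain ⟨P, hP⟩ := h
  refine ⟨P, P.countable_toSet, fun t ⟨ht, htP⟩ => ?_⟩
  have ho : Ioo (0 : ℝ) 1 ∩ (P : Set ℝ)ᶜ ∈ 𝓝 t :=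
    inter_mem (isOpen_Ioo.mem_nhds ht) (P.finite_toSet.isClosed.isOpen_compl.mem_nhds htP)
  obtain ⟨δ, hδ, hs⟩ := Metric.nhds_basis_closedBall.mem_iff.1 ho
  rw [Real.closedBall_eq_Icc] at hs
  have h1 := (hs (left_mem_Icc.2 (by linarith))).1
  have h2 := (hs (right_mem_Icc.2 (by linarith))).1
  exact (hP (t - δ) (t + δ) h1.1.le (by linarith) h2.2.le
    (Set.disjoint_left.2 fun u hu => (hs (Ioo_subset_Icc_self hu)).2)).contDiffAt
    (Icc_mem_nhds (by linarith) (by linarith))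

theorem integrableOn_deriv_of_contDiffOn {f : ℝ → ℂ} {c d : ℝ} (hcd : c < d)
    (h : ContDiffOn ℝ 1 f (Icc c d)) : IntegrableOn (deriv f) (Icc c d) := by
  rw [integrableOn_Icc_iff_integrableOn_Ioo]
  have h1 : IntegrableOn (derivWithin f (Icc c d)) (Icc c d) :=
    (h.continuousOn_derivWithin (uniqueDiffOn_Icc hcd) le_rfl).integrableOn_Icc
  refine (h1.mono_set Ioo_subset_Icc_self).congr_fun (fun t ht => ?_) measurableSet_Ioo
  exact derivWithin_of_mem_nhds (Icc_mem_nhds ht.1 ht.2)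

theorem exists_disjoint_Ioo (P : Finset ℝ) (t : ℝ) :
    ∃ δ > 0, Disjoint (Ioo (t - δ) t) (P : Set ℝ) ∧ Disjoint (Ioo t (t + δ)) (P : Set ℝ) := by
  have ho : ((P.erase t : Finset ℝ) : Set ℝ)ᶜ ∈ 𝓝 t :=
    (P.erase t).finite_toSet.isClosed.isOpen_compl.mem_nhds (by simp)
  obtain ⟨δ, hδ, hs⟩ := Metric.nhds_basis_closedBall.mem_iff.1 ho
  rw [Real.closedBall_eq_Icc] at hs
  refine ⟨δ, hδ, Set.disjoint_left.2 fun u hu hP => ?_, Set.disjoint_left.2 fun u hu hP => ?_⟩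
  · exact hs ⟨hu.1.le, by linarith [hu.2]⟩ (by simpa using ⟨hP, hu.2.ne⟩)
  · exact hs ⟨by linarith [hu.1], hu.2.le⟩ (by simpa using ⟨hP, hu.1.ne'⟩)

theorem IsPiecewiseC1.intervalIntegrable_deriv {x y : ℂ} {γ : Path x y} (h : IsPiecewiseC1 γ) :
    IntervalIntegrable (deriv γ.extend) volume 0 1 := by
  obtain ⟨P, hP⟩ := h
  rw [intervalIntegrable_iff_integrableOn_Icc_of_le zero_le_one]
  refine LocallyIntegrableOn.integrableOn_isCompact (fun t ht => ?_) isCompact_Icc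
  obtain ⟨δ, hδ, h1, h2⟩ := exists_disjoint_Ioo P t
  have hl : IntegrableOn (deriv γ.extend) (Icc (max 0 (t - δ)) t) := by
    rcases lt_or_ge (max 0 (t - δ)) t with hlt | hge
    · refine integrableOn_deriv_of_contDiffOn hlt (hP _ _ (le_max_left _ _) hlt ht.2 ?_)
      exact h1.mono_left (Ioo_subset_Ioo_left (le_max_right _ _))
    · exact IntegrableOn.of_measure_zero (by simp [hge])
  have hr : IntegrableOn (deriv γ.extend) (Icc t (min 1 (t + δ))) := by
    rcases lt_or_ge t (min 1 (t + δ)) with hlt | hge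
    · refine integrableOn_deriv_of_contDiffOn hlt (hP _ _ ht.1 hlt (min_le_left _ _) ?_)
      exact h2.mono_left (Ioo_subset_Ioo_right (min_le_right _ _))
    · exact IntegrableOn.of_measure_zero (by simp [hge])
  refine ⟨Icc (max 0 (t - δ)) t ∪ Icc t (min 1 (t + δ)), ?_, hl.union hr⟩
  refine mem_nhdsWithin_iff_exists_mem_nhds_inter.2
    ⟨Icc (t - δ) (t + δ), Icc_mem_nhds (by linarith) (by linarith), fun u hu => ?_⟩
  rcases le_total u t with hut | hut
  · exact Or.inl ⟨max_le hu.2.1 hu.1.1, hut⟩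
  · exact Or.inr ⟨hut, le_min hu.2.2 hu.1.2⟩

theorem IsPiecewiseC1.intervalIntegrable_deriv_mul {x y : ℂ} {γ : Path x y}
    (h : IsPiecewiseC1 γ) {f : ℂ → ℂ} (hf : ContinuousOn (fun t => f (γ.extend t)) (Icc 0 1)) :
    IntervalIntegrable (fun t => deriv γ.extend t * f (γ.extend t)) volume 0 1 :=
  h.intervalIntegrable_deriv.mul_continuousOn (by rwa [uIcc_of_le zero_le_one])

theorem IsPiecewiseC1.hasDerivAt_integral {x y : ℂ} {γ : Path x y} (h : IsPiecewiseC1 γ)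
    {f : ℂ → ℂ} (hf : ContinuousOn f (range γ)) (hfm : Measurable f) {t : ℝ}
    (ht : t ∈ Ioo (0 : ℝ) 1) (hγ : ContDiffAt ℝ 1 γ.extend t)
    (hft : ContinuousAt f (γ.extend t)) :
    HasDerivAt (fun t => ∫ u in (0 : ℝ)..t, deriv γ.extend u * f (γ.extend u))
      (deriv γ.extend t * f (γ.extend t)) t := by
  have hmem : ∀ u, γ.extend u ∈ range γ := fun u => by
    rw [← Path.extend_range]
    exact mem_range_self u
  have hintegrable := h.intervalIntegrable_deriv_mul
    (hf.comp γ.continuous_extend.continuousOn fun u _ => hmem u)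
  refine intervalIntegral.integral_hasDerivAt_right (hintegrable.mono_set ?_) ?_ ?_
  · rw [uIcc_of_le zero_le_one, uIcc_of_le ht.1.le]
    exact Icc_subset_Icc_right ht.2.le
  · exact ((measurable_deriv _).mul
      (hfm.comp γ.continuous_extend.measurable)).stronglyMeasurable.stronglyMeasurableAtFilter
  · refine ContinuousAt.mul ?_ (hft.comp γ.continuous_extend.continuousAt)
    exact ((hγ.fderiv_right (m := 0) le_rfl).continuousAt.clm_apply continuousAt_const :
      ContinuousAt (fun u => fderiv ℝ γ.extend u 1) t)

theorem eq_of_hasDerivAt_zero_off_countable {f : ℝ → ℂ} {a b : ℝ} {s : Set ℝ} (hs : s.Countable)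
    (hc : ContinuousOn f (Icc a b)) (hd : ∀ t ∈ Ioo a b \ s, HasDerivAt f 0 t) {t : ℝ}
    (ht : t ∈ Icc a b) : f t = f a := by
  have := integral_eq_of_hasDerivAt_off_countable_of_le f (fun _ => 0) ht.1 hs
    (hc.mono (Icc_subset_Icc_right ht.2))
    (fun u hu => hd u ⟨⟨hu.1.1, hu.1.2.trans_le ht.2⟩, hu.2⟩) (by simp)
  rw [intervalIntegral.integral_zero] at this
  exact sub_eq_zero.1 this.symm

theorem IsPiecewiseC1.exists_exp_eq {x : ℂ} {γ : Path x x} (h : IsPiecewiseC1 γ)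
    (h0 : ∀ t, γ.extend t ≠ 0) :
    ∃ (l : ℝ → ℂ) (s : Set ℝ), s.Countable ∧ ContinuousOn l (Icc 0 1) ∧
      (∀ t ∈ Icc (0 : ℝ) 1, γ.extend t = Complex.exp (l t)) ∧
      (∀ t ∈ Ioo (0 : ℝ) 1 \ s, HasDerivAt l (deriv γ.extend t * (γ.extend t)⁻¹) t) ∧
      l 1 = l 0 + 2 * Real.pi * Complex.I * windingNumber γ 0 := by
  obtain ⟨s, hs, hd⟩ := h.exists_countable_contDiffAt
  have hinv : ContinuousOn (fun z : ℂ => z⁻¹) (range γ) := by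
    refine continuousOn_inv₀.mono fun z hz => ?_
    rw [← Path.extend_range] at hz
    obtain ⟨t, rfl⟩ := hz
    exact h0 t
  have hintegrable : IntervalIntegrable (fun t => deriv γ.extend t * (γ.extend t)⁻¹) volume 0 1 :=
    h.intervalIntegrable_deriv_mul (f := fun z => z⁻¹)
      (γ.continuous_extend.continuousOn.inv₀ fun t _ => h0 t)
  let l : ℝ → ℂ := fun t => Complex.log (γ.extend 0) +
    ∫ u in (0 : ℝ)..t, deriv γ.extend u * (γ.extend u)⁻¹
  have hl : ContinuousOn l (Icc 0 1) := by
    have := intervalIntegral.continuousOn_primitive_interval' hintegrable left_mem_uIcc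
    rw [uIcc_of_le zero_le_one] at this
    exact continuousOn_const.add this
  have hl' : ∀ t ∈ Ioo (0 : ℝ) 1 \ s, HasDerivAt l (deriv γ.extend t * (γ.extend t)⁻¹) t :=
    fun t ht => (h.hasDerivAt_integral hinv measurable_inv ht.1 (hd t ht)
      (continuousAt_inv₀ (h0 t))).const_add _
  refine ⟨l, s, hs, hl, fun t ht => ?_, hl', ?_⟩
  · have hconst := eq_of_hasDerivAt_zero_off_countable
      (f := fun t => γ.extend t * Complex.exp (-l t)) hs
      (γ.continuous_extend.continuousOn.mul hl.neg.cexp) (fun u hu => ?_) ht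
    · simp only [l, intervalIntegral.integral_same, add_zero, Complex.exp_neg,
        Complex.exp_log (h0 0), mul_inv_cancel₀ (h0 0)] at hconst
      exact (mul_inv_eq_one₀ (Complex.exp_ne_zero _)).1 hconst
    · have hγu := ((hd u hu).differentiableAt (by simp)).hasDerivAt
      refine (hγu.mul (hl' u hu).neg.cexp).congr_deriv ?_
      have := h0 u
      field_simp
      ring
  · simp [l, two_pi_I_mul_windingNumber]

/-- The open annulus `ε < |z| < R` around the origin. -/
def annulus (ε R : ℝ) : Set ℂ := {z | ε < ‖z‖ ∧ ‖z‖ < R}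

theorem isOpen_annulus (ε R : ℝ) : IsOpen (annulus ε R) :=
  (isOpen_lt continuous_const continuous_norm).inter (isOpen_lt continuous_norm continuous_const)

theorem sphere_subset_annulus {ε R ρ : ℝ} (hρ : ρ ∈ Ioo ε R) :
    Metric.sphere (0 : ℂ) ρ ⊆ annulus ε R := fun z hz => by
  rwa [annulus, mem_ofPred_eq, mem_sphere_zero_iff_norm.1 hz]

theorem convex_exp_preimage_annulus (ε R : ℝ) : Convex ℝ (Complex.exp ⁻¹' annulus ε R) := by
  have h : Complex.exp ⁻¹' annulus ε R = Complex.reLm ⁻¹' (Real.exp ⁻¹' Ioo ε R) := by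
    ext w
    simp [annulus, Complex.norm_exp]
  rw [h]
  exact (ordConnected_Ioo.preimage_mono Real.exp_monotone).convex.is_linear_preimage
    Complex.reLm.isLinear

theorem isOpen_exp_preimage_annulus (ε R : ℝ) : IsOpen (Complex.exp ⁻¹' annulus ε R) :=
  (isOpen_annulus ε R).preimage Complex.continuous_exp

section Annulus

variable {ε R : ℝ} {g G : ℂ → ℂ}

theorem exists_hasDerivAt_comp_exp (hg : DifferentiableOn ℂ g (annulus ε R)) :
    ∃ G : ℂ → ℂ, ∀ w, Complex.exp w ∈ annulus ε R →
      HasDerivAt G (g (Complex.exp w) * Complex.exp w) w := by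
  have hexp : DifferentiableOn ℂ Complex.exp (Complex.exp ⁻¹' annulus ε R) :=
    Complex.differentiable_exp.differentiableOn
  obtain ⟨G, hG⟩ := (convex_exp_preimage_annulus ε R).exists_forall_hasDerivWithinAt
    ((hg.comp hexp fun w hw => hw).mul hexp)
  exact ⟨G, fun w hw => (hG w hw).hasDerivAt ((isOpen_exp_preimage_annulus ε R).mem_nhds hw)⟩

theorem sub_eq_sub_of_hasDerivAt_comp_exp
    (hG : ∀ w, Complex.exp w ∈ annulus ε R →
      HasDerivAt G (g (Complex.exp w) * Complex.exp w) w)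
    {v w : ℂ} (hv : Complex.exp v ∈ annulus ε R)
    (hw : Complex.exp w ∈ annulus ε R) :
    G (v + 2 * Real.pi * Complex.I) - G v = G (w + 2 * Real.pi * Complex.I) - G w := by
  have hd : ∀ w, Complex.exp w ∈ annulus ε R →
      HasDerivAt (fun w => G (w + 2 * Real.pi * Complex.I) - G w) 0 w := fun w hw => by
    have hperiod := (hG (w + 2 * Real.pi * Complex.I)
      (by rwa [Complex.exp_periodic w])).comp_add_const w (2 * Real.pi * Complex.I)
    exact (hperiod.sub (hG w hw)).congr_deriv (by rw [Complex.exp_periodic w, sub_self])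
  exact (isOpen_exp_preimage_annulus ε R).is_const_of_deriv_eq_zero
    (convex_exp_preimage_annulus ε R).isPreconnected
    (fun w hw => (hd w hw).differentiableAt.differentiableWithinAt)
    (fun w hw => (hd w hw).deriv) hv hw

theorem sub_eq_circleIntegral_of_hasDerivAt_comp_exp
    (hG : ∀ w, Complex.exp w ∈ annulus ε R →
      HasDerivAt G (g (Complex.exp w) * Complex.exp w) w)
    (hg : ContinuousOn g (annulus ε R)) {ρ : ℝ} (hρ0 : 0 < ρ) (hρ : ρ ∈ Ioo ε R)
    {w : ℂ} (hw : Complex.exp w ∈ annulus ε R) :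
    G (w + 2 * Real.pi * Complex.I) - G w = ∮ z in C(0, ρ), g z := by
  have hexp : ∀ θ : ℝ, Complex.exp (Real.log ρ + θ * Complex.I) = circleMap 0 ρ θ := fun θ => by
    rw [Complex.exp_add, ← Complex.ofReal_exp, Real.exp_log hρ0, circleMap, zero_add]
  have hmem : ∀ θ : ℝ, Complex.exp (Real.log ρ + θ * Complex.I) ∈ annulus ε R := fun θ =>
    sphere_subset_annulus hρ (hexp θ ▸ circleMap_mem_sphere _ hρ0.le _)
  have hderiv : ∀ θ ∈ uIcc 0 (2 * Real.pi), HasDerivAt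
      (fun θ : ℝ => G (Real.log ρ + θ * Complex.I))
      (deriv (circleMap 0 ρ) θ • g (circleMap 0 ρ θ)) θ := fun θ _ => by
    have hline : HasDerivAt (fun θ : ℝ => (Real.log ρ : ℂ) + θ * Complex.I) Complex.I θ := by
      simpa using ((Complex.ofRealCLM.hasDerivAt (x := θ)).mul_const Complex.I).const_add
        (Real.log ρ : ℂ)
    refine ((hG _ (hmem θ)).scomp θ hline).congr_deriv ?_
    rw [hexp, deriv_circleMap, smul_eq_mul, smul_eq_mul]
    ring
  have hintegrable : CircleIntegrable g 0 ρ :=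
    (hg.mono (sphere_subset_annulus hρ)).circleIntegrable hρ0.le
  rw [circleIntegral, intervalIntegral.integral_eq_sub_of_hasDerivAt hderiv hintegrable.out,
    sub_eq_sub_of_hasDerivAt_comp_exp hG hw (hmem 0)]
  push_cast
  simp

theorem sub_eq_int_mul_circleIntegral_of_hasDerivAt_comp_exp
    (hG : ∀ w, Complex.exp w ∈ annulus ε R →
      HasDerivAt G (g (Complex.exp w) * Complex.exp w) w)
    (hg : ContinuousOn g (annulus ε R)) {ρ : ℝ} (hρ0 : 0 < ρ) (hρ : ρ ∈ Ioo ε R) (n : ℤ) {w : ℂ}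
    (hw : Complex.exp w ∈ annulus ε R) :
    G (w + n * (2 * Real.pi * Complex.I)) - G w = n * ∮ z in C(0, ρ), g z := by
  have hstep := fun k : ℤ => sub_eq_circleIntegral_of_hasDerivAt_comp_exp hG hg hρ0 hρ
    (w := w + k * (2 * Real.pi * Complex.I)) (by rwa [Complex.exp_periodic.int_mul k w])
  induction n with
  | zero => simp
  | succ n ih =>
    have := hstep n
    push_cast at this ih ⊢
    rw [add_one_mul, ← add_assoc]
    linear_combination this + ih
  | pred n ih =>
    have := hstep (-n - 1)
    push_cast at this ih ⊢
    rw [add_assoc w, sub_one_mul, sub_add_cancel] at this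
    rw [sub_one_mul]
    linear_combination ih - this

/-- Lift the contour and the circle to the universal cover `exp` of the annulus, where `g(z) dz`
pulls back to an exact form. -/
theorem contourIntegral_eq_windingNumber_mul_circleIntegral
    (hg : DifferentiableOn ℂ g (annulus ε R)) (hε : 0 < ε) {ρ : ℝ} (hρ : ρ ∈ Ioo ε R) {x : ℂ}
    {γ : Path x x} (h : IsPiecewiseC1 γ) (hγ : ∀ t, γ.extend t ∈ annulus ε R) :
    contourIntegral g γ = windingNumber γ 0 * ∮ z in C(0, ρ), g z := by
  obtain ⟨G, hG⟩ := exists_hasDerivAt_comp_exp hg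
  have h0 : ∀ t, γ.extend t ≠ 0 := fun t => norm_pos_iff.1 (hε.trans (hγ t).1)
  obtain ⟨l, s, hs, hl, hle, hl', hl1⟩ := h.exists_exp_eq h0
  have hlmem : ∀ t ∈ Icc (0 : ℝ) 1, Complex.exp (l t) ∈ annulus ε R := fun t ht =>
    hle t ht ▸ hγ t
  obtain ⟨n, hn⟩ : ∃ n : ℤ, l 1 = l 0 + n * (2 * Real.pi * Complex.I) := by
    rw [← Complex.exp_eq_exp_iff_exists_int, ← hle 1 (by simp), ← hle 0 (by simp)]
    simp
  have hwn : windingNumber γ 0 = n :=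
    mul_left_cancel₀ Complex.two_pi_I_ne_zero (by linear_combination hn - hl1)
  rw [hwn, ← sub_eq_int_mul_circleIntegral_of_hasDerivAt_comp_exp hG hg.continuousOn
    (hε.trans hρ.1) hρ n (hlmem 0 (by simp)), ← hn, contourIntegral_eq]
  refine integral_eq_of_hasDerivAt_off_countable_of_le (fun t => G (l t)) _ zero_le_one hs ?_
    (fun t ht => ?_) (h.intervalIntegrable_deriv_mul
      (hg.continuousOn.comp γ.continuous_extend.continuousOn fun t _ => hγ t))
  · exact ContinuousOn.comp (fun w hw => (hG w hw).continuousAt.continuousWithinAt) hl hlmem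
  · have htI := Ioo_subset_Icc_self ht.1
    refine ((hG _ (hlmem t htI)).scomp t (hl' t ht)).congr_deriv ?_
    have := h0 t
    rw [← hle t htI, smul_eq_mul]
    field_simp

end Annulus

section PrincipalParts

variable {U : Set ℂ} {F : ℂ → ℂ}

theorem exists_differentiableOn_eq_add_mul_inv (hU : IsOpen U) {p c : ℂ} (hp : p ∈ U)
    (hF : DifferentiableOn ℂ F (U \ {p}))
    (hc : Tendsto (fun z => (z - p) * F z) (𝓝[≠] p) (𝓝 c)) :
    ∃ g : ℂ → ℂ, DifferentiableOn ℂ g U ∧ ∀ z ≠ p, F z = g z + c * (z - p)⁻¹ := by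
  let F₀ : ℂ → ℂ := fun z => F z - c * (z - p)⁻¹
  have hF₀ : DifferentiableOn ℂ F₀ (U \ {p}) := fun z hz => by
    have hzp : z - p ≠ 0 := sub_ne_zero.2 hz.2
    have hpole : DifferentiableAt ℂ (fun z => c * (z - p)⁻¹) z := by
      fun_prop (disch := assumption)
    exact (hF z hz).sub hpole.differentiableWithinAt
  have hconst : Tendsto (fun z => (z - p) * F₀ p) (𝓝[≠] p) (𝓝 ((p - p) * F₀ p)) :=
    (Continuous.tendsto (by fun_prop) p).mono_left nhdsWithin_le_nhds
  have hlim : Tendsto (fun z => (z - p) * (F₀ z - F₀ p)) (𝓝[≠] p) (𝓝 0) := by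
    have h := (hc.sub_const c).sub hconst
    rw [sub_self, sub_self, zero_mul, sub_zero] at h
    refine h.congr' ?_
    filter_upwards [self_mem_nhdsWithin] with z hz
    have : z - p ≠ 0 := sub_ne_zero.2 hz
    simp only [F₀]
    field_simp
  refine ⟨Function.update F₀ p (limUnder (𝓝[≠] p) F₀),
    Complex.differentiableOn_update_limUnder_of_isLittleO (hU.mem_nhds hp) hF₀ ?_, fun z hz => ?_⟩
  · rw [Asymptotics.isLittleO_iff_tendsto']
    · exact hlim.congr fun z => by rw [div_inv_eq_mul, mul_comm]
    · filter_upwards [self_mem_nhdsWithin] with z hz h0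
      exact absurd (inv_eq_zero.1 h0) (sub_ne_zero.2 hz)
  · rw [Function.update_of_ne hz, sub_add_cancel]

theorem exists_differentiableOn_eq_add_sum {ι : Type*} {s : Finset ι} {p c : ι → ℂ}
    (hU : IsOpen U) (hp : InjOn p s) (hpU : ∀ i ∈ s, p i ∈ U)
    (hF : DifferentiableOn ℂ F (U \ p '' s))
    (hc : ∀ i ∈ s, Tendsto (fun z => (z - p i) * F z) (𝓝[≠] p i) (𝓝 (c i))) :
    ∃ g : ℂ → ℂ, DifferentiableOn ℂ g U ∧
      ∀ z ∉ p '' s, F z = g z + ∑ i ∈ s, c i * (z - p i)⁻¹ := by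
  classical
  induction s using Finset.induction_on generalizing F with
  | empty => exact ⟨F, by simpa using hF, by simp⟩
  | insert i s hi ih =>
    simp only [Finset.forall_mem_insert] at hpU hc
    rw [Finset.coe_insert, image_insert_eq] at hF
    rw [Finset.coe_insert, injOn_insert (by simpa using hi)] at hp
    obtain ⟨F₁, hF₁, hFF₁⟩ := exists_differentiableOn_eq_add_mul_inv
      (hU.sdiff (s.finite_toSet.image p).isClosed) ⟨hpU.1, hp.2⟩
      (hF.mono fun z hz => ⟨hz.1.1, not_or.2 ⟨hz.2, hz.1.2⟩⟩) hc.1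
    obtain ⟨g, hg, hgF⟩ := ih hp.1 hpU.2 hF₁ fun j hj => by
      have hji : p j ≠ p i := fun h => hp.2 ⟨j, hj, h⟩
      have hcont : ContinuousAt (fun z => (z - p j) * (c i * (z - p i)⁻¹)) (p j) := by
        have := sub_ne_zero.2 hji
        fun_prop (disch := assumption)
      have h := (hc.2 j hj).sub (hcont.tendsto.mono_left nhdsWithin_le_nhds)
      rw [sub_self, zero_mul, sub_zero] at h
      refine h.congr' ?_
      filter_upwards [nhdsWithin_le_nhds (isOpen_ne.mem_nhds hji)] with z hz
      rw [hFF₁ z hz]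
      ring
    refine ⟨g, hg, fun z hz => ?_⟩
    rw [Finset.coe_insert, image_insert_eq, mem_insert_iff, not_or] at hz
    rw [hFF₁ z hz.1, hgF z hz.2, Finset.sum_insert hi]
    ring

end PrincipalParts

theorem IsPiecewiseC1.ae_deriv_eq_zero {x y : ℂ} {γ : Path x y} (h : IsPiecewiseC1 γ) (p : ℂ) :
    ∀ᵐ t : ℝ, t ∈ Ioo (0 : ℝ) 1 → γ.extend t = p → deriv γ.extend t = 0 := by
  obtain ⟨s, hs, hd⟩ := h.exists_countable_contDiffAt
  -- Where the derivative does not vanish, the points of the level set are isolated.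
  let T : Set ℝ := {t | t ∈ Ioo (0 : ℝ) 1 \ s ∧ γ.extend t = p ∧ deriv γ.extend t ≠ 0}
  have hT : T.Countable := by
    refine (countable_setOfPred_isolated_right_within (s := T)).mono fun t ht => ?_
    refine mem_ofPred_eq ▸ ⟨ht, ?_⟩
    have hne := ((hd t ht.1).differentiableAt (by simp)).hasDerivAt.eventually_ne (c := p) ht.2.2
    have hsub : T ∩ Ioi t ⊆ {t}ᶜ := fun u hu => hu.2.ne'
    rw [← empty_mem_iff_bot]
    filter_upwards [nhdsWithin_mono t hsub hne, self_mem_nhdsWithin] with u hu hu'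
    exact hu hu'.1.2.1
  filter_upwards [(hs.union hT).ae_notMem volume] with t ht htI htp
  by_contra hne
  exact ht (Or.inr ⟨⟨htI, fun h => ht (Or.inl h)⟩, htp, hne⟩)

section Residues

variable {ι : Type*} {s : Finset ι} {p c : ι → ℂ} {F g : ℂ → ℂ}

/-- A pole with `c i = 0` may lie on the path: there `F` may differ from the right-hand side, but
the path then has zero derivative almost everywhere. -/
theorem contourIntegral_eq_add_sum {x : ℂ} {γ : Path x x} (h : IsPiecewiseC1 γ)
    (hg : ContinuousOn g (range γ))
    (hF : ∀ z ∈ range γ, z ∉ p '' s → F z = g z + ∑ i ∈ s, c i * (z - p i)⁻¹)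
    (hγ : ∀ i ∈ s, c i ≠ 0 → p i ∉ range γ) :
    contourIntegral F γ = contourIntegral g γ +
      2 * Real.pi * Complex.I * ∑ i ∈ s, c i * windingNumber γ (p i) := by
  rw [← Path.extend_range] at *
  have hterm : ∀ i ∈ s, IntervalIntegrable
      (fun t => c i * (deriv γ.extend t * (γ.extend t - p i)⁻¹)) volume 0 1 := fun i hi => by
    rcases eq_or_ne (c i) 0 with h0 | h0
    · simp [h0]
    · exact (h.intervalIntegrable_deriv_mul (f := fun z => (z - p i)⁻¹)
        ((γ.continuous_extend.sub continuous_const).continuousOn.inv₀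
          fun t _ => sub_ne_zero.2 fun ht => hγ i hi h0 ⟨t, ht⟩)).const_mul _
  have hgint := h.intervalIntegrable_deriv_mul
    (hg.comp γ.continuous_extend.continuousOn fun t _ => mem_range_self t)
  have hae : ∀ᵐ t : ℝ, ∀ i ∈ s, t ∈ Ioo (0 : ℝ) 1 → γ.extend t = p i → deriv γ.extend t = 0 :=
    (ae_ball_iff s.countable_toSet).2 fun i _ => h.ae_deriv_eq_zero (p i)
  simp only [Finset.mul_sum, mul_left_comm _ (c _), two_pi_I_mul_windingNumber,
    ← intervalIntegral.integral_const_mul]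
  rw [← intervalIntegral.integral_finsetSum hterm, contourIntegral_eq, contourIntegral_eq,
    ← intervalIntegral.integral_add hgint
      ((IntervalIntegrable.sum s hterm).congr fun t _ => by simp)]
  refine intervalIntegral.integral_congr_ae ?_
  rw [uIoc_of_le zero_le_one]
  filter_upwards [hae, (countable_singleton (1 : ℝ)).ae_notMem volume] with t ht ht1 htI
  by_cases htp : γ.extend t ∈ p '' s
  · obtain ⟨i, hi, hit⟩ := htp
    simp [ht i hi ⟨htI.1, htI.2.lt_of_ne ht1⟩ hit.symm]
  · rw [hF _ (mem_range_self t) htp, mul_add, Finset.mul_sum]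
    congr 1
    exact Finset.sum_congr rfl fun i _ => by ring

theorem circleIntegral_sub_inv {ρ : ℝ} (hρ : 0 ≤ ρ) {p : ℂ} (hp : ‖p‖ ≠ ρ) :
    (∮ z in C(0, ρ), (z - p)⁻¹) = 2 * Real.pi * Complex.I * if ‖p‖ < ρ then 1 else 0 := by
  split_ifs with hlt
  · rw [circleIntegral.integral_sub_inv_of_mem_ball (by simpa using hlt), mul_one]
  · have hne : ∀ z ∈ Metric.closedBall (0 : ℂ) ρ, z - p ≠ 0 := fun z hz h0 => by
      rw [mem_closedBall_zero_iff, sub_eq_zero.1 h0] at hz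
      exact hlt (hz.lt_of_ne hp)
    rw [mul_zero]
    refine Complex.circleIntegral_eq_zero_of_differentiable_on_off_countable hρ countable_empty
      ((continuousOn_id.sub continuousOn_const).inv₀ hne) fun z hz => ?_
    have := hne z (Metric.ball_subset_closedBall hz.1)
    fun_prop (disch := assumption)

theorem circleIntegral_eq_add_sum {ρ : ℝ} (hρ : 0 ≤ ρ) (hg : ContinuousOn g (Metric.sphere 0 ρ))
    (hF : ∀ z ∈ Metric.sphere 0 ρ, z ∉ p '' s → F z = g z + ∑ i ∈ s, c i * (z - p i)⁻¹)
    (hp : ∀ i ∈ s, ‖p i‖ ≠ ρ) :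
    (∮ z in C(0, ρ), F z) = (∮ z in C(0, ρ), g z) +
      2 * Real.pi * Complex.I * ∑ i ∈ s, c i * if ‖p i‖ < ρ then 1 else 0 := by
  have hne : ∀ i ∈ s, ∀ z ∈ Metric.sphere (0 : ℂ) ρ, z ≠ p i := fun i hi z hz h =>
    hp i hi (by rwa [mem_sphere_zero_iff_norm, h] at hz)
  have hterm : ∀ i ∈ s, CircleIntegrable (fun z => c i * (z - p i)⁻¹) 0 ρ := fun i hi =>
    ContinuousOn.circleIntegrable hρ (continuousOn_const.mul
      ((continuousOn_id.sub continuousOn_const).inv₀ fun z hz => sub_ne_zero.2 (hne i hi z hz)))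
  rw [circleIntegral.integral_congr hρ fun z hz => hF z hz fun ⟨i, hi, h⟩ => hne i hi z hz h.symm,
    circleIntegral.integral_add (hg.circleIntegrable hρ) (CircleIntegrable.fun_sum s hterm),
    circleIntegral.integral_fun_sum hterm, Finset.mul_sum]
  congr 1
  refine Finset.sum_congr rfl fun i hi => ?_
  rw [circleIntegral.integral_const_mul, circleIntegral_sub_inv hρ (hp i hi)]
  ring

theorem contourIntegral_eq_circleIntegral_add {ε R ρ : ℝ} (hε : 0 < ε) (hρ : ρ ∈ Ioo ε R)
    (hp : InjOn p s) (hpU : ∀ i ∈ s, p i ∈ annulus ε R)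
    (hF : DifferentiableOn ℂ F (annulus ε R \ p '' s))
    (hc : ∀ i ∈ s, Tendsto (fun z => (z - p i) * F z) (𝓝[≠] p i) (𝓝 (c i)))
    (hpρ : ∀ i ∈ s, ‖p i‖ ≠ ρ) {x : ℂ} {γ : Path x x} (h : IsPiecewiseC1 γ)
    (hγ : range γ ⊆ annulus ε R) (hpγ : ∀ i ∈ s, c i ≠ 0 → p i ∉ range γ) :
    contourIntegral F γ = windingNumber γ 0 * (∮ z in C(0, ρ), F z) +
      2 * Real.pi * Complex.I * ∑ i ∈ s,
        c i * (windingNumber γ (p i) - windingNumber γ 0 * if ‖p i‖ < ρ then 1 else 0) := by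
  obtain ⟨g, hg, hgF⟩ := exists_differentiableOn_eq_add_sum (isOpen_annulus ε R) hp hpU hF hc
  rw [contourIntegral_eq_add_sum h (hg.continuousOn.mono hγ) (fun z _ => hgF z) hpγ,
    circleIntegral_eq_add_sum (hε.trans hρ.1).le
      (hg.continuousOn.mono (sphere_subset_annulus hρ)) (fun z _ => hgF z) hpρ,
    contourIntegral_eq_windingNumber_mul_circleIntegral hg hε hρ h
      fun t => hγ (by rw [← Path.extend_range]; exact mem_range_self t)]
  simp only [mul_sub, Finset.sum_sub_distrib, mul_left_comm (c _), ← Finset.mul_sum]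
  ring

end Residues

end ContourIntegral

section QKernel

open Filter Topology Finset

variable {q : ℂ}

variable {ι : Type*} {α β A B : ι → ℂ} {k : ℤ}

/-- The geometric sequences `B_j q^s` of poles. -/
def poleSeq (q : ℂ) (B : ι → ℂ) (x : ι × ℕ) : ℂ := B x.1 * q ^ x.2

/-- The zeros of the denominator of `qKernel q α β A B k`: geometric sequences converging to `0`
on the left summand and to `∞` on the right one. -/
def qKernelPole (q : ℂ) (A B : ι → ℂ) : (ι × ℕ) ⊕ (ι × ℕ) → ℂ :=
  Sum.elim (poleSeq q B) fun x => (poleSeq q A x)⁻¹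

theorem injective_qKernelPole_symm (hp : (qKernelPole q A B).Injective) :
    (qKernelPole q B A).Injective := fun x y h => by
  have hswap : ∀ x, qKernelPole q A B (Sum.swap x) = (qKernelPole q B A x)⁻¹ := by
    rintro (x | x) <;> simp [qKernelPole]
  exact Sum.swap_leftInverse.injective (hp (by rw [hswap, hswap, h]))

theorem poleSeq_ne_zero (hp : (qKernelPole q A B).Injective) (x : ι × ℕ) : poleSeq q B x ≠ 0 :=
  fun h => by
    have hsucc : poleSeq q B (x.1, x.2 + 1) = poleSeq q B x * q := by
      rw [poleSeq, poleSeq, pow_succ, mul_assoc]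
    have hx := @hp (Sum.inl (x.1, x.2 + 1)) (Sum.inl x) (by
      simp only [qKernelPole, Sum.elim_inl, hsucc, h, zero_mul])
    simpa using congrArg Prod.snd (Sum.inl_injective hx)

theorem div_poleSeq_self (hp : (qKernelPole q A B).Injective) (j : ι) (s : ℕ) :
    B j / poleSeq q B (j, s) = q ^ (-s : ℤ) := by
  have h := left_ne_zero_of_mul (poleSeq_ne_zero hp (j, s))
  rw [poleSeq, zpow_neg, zpow_natCast, div_mul_cancel_left₀ h]

theorem div_poleSeq_self_mul_pow (hq0 : q ≠ 0) (hp : (qKernelPole q A B).Injective) (j : ι)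
    (s : ℕ) : B j / poleSeq q B (j, s) * q ^ (s + 1) = q := by
  rw [div_poleSeq_self hp, zpow_neg, zpow_natCast, pow_succ,
    inv_mul_cancel_left₀ (pow_ne_zero s hq0)]

theorem qPoch_div_ne_zero (hq : ‖q‖ < 1) {c z : ℂ} (hz : z ≠ 0) (h : ∀ s : ℕ, z ≠ c * q ^ s) :
    qPoch (c / z) q ≠ 0 :=
  qPoch_ne_zero hq fun s hs => h s (by rw [← div_mul_cancel₀ c hz, mul_right_comm, hs, one_mul])

theorem qPoch_mul_ne_zero (hq : ‖q‖ < 1) {c z : ℂ} (h : ∀ s : ℕ, z ≠ (c * q ^ s)⁻¹) :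
    qPoch (c * z) q ≠ 0 :=
  qPoch_ne_zero hq fun s hs => h s (eq_inv_of_mul_eq_one_left (by rw [← hs]; ring))

theorem differentiableAt_qPoch_div (hq : ‖q‖ < 1) (c : ℂ) {z : ℂ} (hz : z ≠ 0) :
    DifferentiableAt ℂ (fun z => qPoch (c / z) q) z :=
  (differentiable_qPoch hq (c / z)).comp z (by fun_prop (disch := assumption))

theorem differentiableAt_qPoch_mul (hq : ‖q‖ < 1) (c z : ℂ) :
    DifferentiableAt ℂ (fun z => qPoch (c * z) q) z :=
  (differentiable_qPoch hq (c * z)).comp z (by fun_prop)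

theorem qPoch_div_eq_sub_mul (hq : ‖q‖ < 1) (c : ℂ) {z : ℂ} (hz : z ≠ 0) (s : ℕ) :
    qPoch (c / z) q = (z - c * q ^ s) / z * (qFac (c / z) q s * qPoch (c / z * q ^ (s + 1)) q) := by
  rw [qPoch_eq_qFac_mul hq (c / z) (s + 1), qFac_succ, sub_div, div_self hz, mul_div_right_comm]
  ring

theorem continuous_qFac (q : ℂ) (s : ℕ) : Continuous fun x => qFac x q s := by
  unfold qFac
  fun_prop

theorem qFac_zpow_neg_ne_zero (hq : ‖q‖ < 1) (hq0 : q ≠ 0) (s : ℕ) :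
    qFac (q ^ (-s : ℤ)) q s ≠ 0 := by
  refine prod_ne_zero_iff.2 fun i hi h => ?_
  rw [sub_eq_zero, ← zpow_natCast, ← zpow_add₀ hq0, ← zpow_zero q] at h
  have hs := zpow_right_injective₀ (norm_pos_iff.2 hq0) hq.ne
    (by simpa only [norm_zpow] using congrArg norm h)
  have := mem_range.1 hi
  omega

theorem hasSum_fintype_prod [Fintype ι] {f : ι × ℕ → ℂ} {g : ι → ℂ}
    (h : ∀ j, HasSum (fun s => f (j, s)) (g j)) : HasSum f (∑ j, g j) := by
  have hs : Summable f := Summable.of_norm ((summable_prod_of_nonneg fun _ => norm_nonneg _).2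
    ⟨fun j => (h j).summable.norm, Summable.of_finite⟩)
  exact (hs.hasSum.prod_fiberwise h).unique (hasSum_fintype g) ▸ hs.hasSum

theorem norm_poleSeq_le [Fintype ι] (hq : ‖q‖ < 1) (B : ι → ℂ) (x : ι × ℕ) :
    ‖poleSeq q B x‖ ≤ ∑ i, ‖B i‖ := by
  rw [poleSeq, norm_mul, norm_pow]
  exact (mul_le_of_le_one_right (norm_nonneg _) (pow_le_one₀ (norm_nonneg _) hq.le)).trans
    (single_le_sum (fun i _ => norm_nonneg (B i)) (mem_univ x.1))

theorem exists_Ioo_forall_norm_poleSeq_ne [Countable ι] (hq0 : q ≠ 0) (B : ι → ℂ)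
    {δ : ℝ} (hδ : 0 < δ) :
    ∃ ρ ∈ Set.Ioo 0 δ, ∀ (n : ℕ) (y : ι × ℕ), ‖poleSeq q B y‖ ≠ ρ * ‖q‖ ^ n := by
  have hS : (Set.range fun y : ℕ × ι × ℕ => ‖poleSeq q B y.2‖ / ‖q‖ ^ y.1).Countable :=
    Set.countable_range _
  obtain ⟨ρ, hρS, hρ⟩ := hS.dense_compl ℝ |>.exists_mem_open isOpen_Ioo (Set.nonempty_Ioo.2 hδ)
  refine ⟨ρ, hρ, fun n y h => hρS ⟨(n, y), ?_⟩⟩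
  simp [h, hq0]

section FiniteIndex

variable [Finite ι]

theorem eventually_lt_norm_inv_poleSeq (hq : ‖q‖ < 1) (hp : (qKernelPole q A B).Injective) :
    ∀ᶠ ρ in 𝓝[>] (0 : ℝ), ∀ x, ρ < ‖(poleSeq q A x)⁻¹‖ := by
  cases nonempty_fintype ι
  have hS : 0 < 1 + ∑ i, ‖A i‖ := by positivity
  filter_upwards [Ioo_mem_nhdsGT (inv_pos.2 hS)] with ρ hρ x
  have hx := norm_pos_iff.2 (poleSeq_ne_zero (injective_qKernelPole_symm hp) x)
  rw [norm_inv]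
  refine hρ.2.trans_le (inv_anti₀ hx ?_)
  linarith [norm_poleSeq_le hq A x]

theorem tendsto_poleSeq_cofinite (hq : ‖q‖ < 1) (B : ι → ℂ) :
    Tendsto (poleSeq q B) cofinite (𝓝 0) := by
  cases nonempty_fintype ι
  exact (hasSum_fintype_prod fun j =>
    (hasSum_geometric_of_norm_lt_one hq).mul_left (B j)).summable.tendsto_cofinite_zero

theorem finite_lt_norm_poleSeq (hq : ‖q‖ < 1) (B : ι → ℂ) {ε : ℝ} (hε : 0 < ε) :
    {x | ε < ‖poleSeq q B x‖}.Finite := by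
  have h := (tendsto_poleSeq_cofinite hq B).norm.eventually_lt_const (norm_zero.trans_lt hε)
  exact (eventually_cofinite.1 h).subset fun x hx => (le_of_lt hx).not_gt

theorem tendsto_toFinset_lt_norm_poleSeq (hq : ‖q‖ < 1) (B : ι → ℂ)
    (hB : ∀ y, poleSeq q B y ≠ 0) {u : ℕ → ℝ} (hu : ∀ n, 0 < u n)
    (hlim : Tendsto u atTop (𝓝 0)) :
    Tendsto (fun n => (finite_lt_norm_poleSeq hq B (hu n)).toFinset) atTop atTop :=
  tendsto_atTop.2 fun F => ((eventually_all_finset F).2 fun y _ =>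
    hlim.eventually_lt_const (norm_pos_iff.2 (hB y))).mono fun n hn y hy => by simpa using hn y hy

theorem finite_qKernelPole_preimage_annulus (hq : ‖q‖ < 1) (A B : ι → ℂ) {ε R : ℝ} (hε : 0 < ε) :
    (qKernelPole q A B ⁻¹' annulus ε R).Finite := by
  rcases le_or_gt R 0 with hR | hR
  · convert Set.finite_empty
    refine Set.eq_empty_of_forall_notMem fun x hx => ?_
    linarith [hx.1, hx.2]
  refine (((finite_lt_norm_poleSeq hq B hε).image Sum.inl).union
    ((finite_lt_norm_poleSeq hq A (inv_pos.2 hR)).image Sum.inr)).subset ?_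
  rintro (x | x) ⟨hε', hR'⟩
  · exact Or.inl ⟨x, hε', rfl⟩
  · refine Or.inr ⟨x, ?_, rfl⟩
    simp only [qKernelPole, Sum.elim_inr, norm_inv] at hε' hR'
    exact inv_lt_of_inv_lt₀ (inv_pos.1 (hε.trans hε')) hR'

end FiniteIndex

variable [Fintype ι]

/-- The product of quotients of infinite `q`-shifted factorials to which, up to sign, the integrand
specializes. -/
def qKernel (q : ℂ) (α β A B : ι → ℂ) (k : ℤ) (z : ℂ) : ℂ :=
  (∏ i, qPoch (α i / z) q * qPoch (β i * z) q) /
    ((∏ i, qPoch (A i * z) q) * ∏ i, qPoch (B i / z) q) * z ^ k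

theorem qKernel_inv (q : ℂ) (α β A B : ι → ℂ) (k : ℤ) (z : ℂ) :
    qKernel q α β A B k z⁻¹ = qKernel q β α B A (-k) z := by
  simp only [qKernel, div_inv_eq_mul, ← div_eq_mul_inv, inv_zpow']
  rw [mul_comm (∏ i, qPoch (A i / z) q)]
  simp only [mul_comm (qPoch (α _ * z) q)]

theorem differentiableAt_qKernel_numerator (hq : ‖q‖ < 1) {z : ℂ} (hz : z ≠ 0) :
    DifferentiableAt ℂ (fun z => ∏ i, qPoch (α i / z) q * qPoch (β i * z) q) z :=
  DifferentiableAt.fun_finsetProd fun _ _ =>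
    (differentiableAt_qPoch_div hq _ hz).mul (differentiableAt_qPoch_mul hq _ z)

theorem differentiableAt_qKernel (hq : ‖q‖ < 1) {z : ℂ} (hz : z ≠ 0)
    (h : z ∉ Set.range (qKernelPole q A B)) : DifferentiableAt ℂ (qKernel q α β A B k) z := by
  refine ((differentiableAt_qKernel_numerator hq hz).div (DifferentiableAt.mul ?_ ?_)
    (mul_ne_zero ?_ ?_)).mul (differentiableAt_zpow.2 (Or.inl hz))
  · exact DifferentiableAt.fun_finsetProd fun _ _ => differentiableAt_qPoch_mul hq _ z
  · exact DifferentiableAt.fun_finsetProd fun _ _ => differentiableAt_qPoch_div hq _ hz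
  · exact prod_ne_zero_iff.2 fun i _ =>
      qPoch_mul_ne_zero hq fun s hs => h ⟨Sum.inr (i, s), hs.symm⟩
  · exact prod_ne_zero_iff.2 fun i _ =>
      qPoch_div_ne_zero hq hz fun s hs => h ⟨Sum.inl (i, s), hs.symm⟩

section Residue

variable [DecidableEq ι]

/-- The factor of `qKernel q α β A B k` that is regular at the pole `B_j q^s`. -/
def qKernelCofactor (q : ℂ) (α β A B : ι → ℂ) (k : ℤ) (j : ι) (s : ℕ) (z : ℂ) : ℂ :=
  (∏ i, qPoch (α i / z) q * qPoch (β i * z) q) /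
    ((∏ i, qPoch (A i * z) q) * ((∏ i ∈ univ.erase j, qPoch (B i / z) q) *
      (qFac (B j / z) q s * qPoch (B j / z * q ^ (s + 1)) q))) * z ^ k

theorem qKernel_eq_mul_cofactor (hq : ‖q‖ < 1) {z : ℂ} (hz : z ≠ 0) (j : ι) (s : ℕ) :
    qKernel q α β A B k z =
      z / (z - B j * q ^ s) * qKernelCofactor q α β A B k j s z := by
  rw [qKernel, qKernelCofactor, ← mul_prod_erase univ (fun i => qPoch (B i / z) q) (mem_univ j),
    qPoch_div_eq_sub_mul hq _ hz s]
  simp only [div_eq_mul_inv, mul_inv, inv_inv]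
  ring

/-- The residue at `z = B_j q^s` of `qKernel q α β A B k z / z`. -/
def qKernelResidue (q : ℂ) (α β A B : ι → ℂ) (k : ℤ) (j : ι) (s : ℕ) : ℂ :=
  (∏ i, qPoch (α i / (B j * q ^ s)) q * qPoch (β i * (B j * q ^ s)) q) /
    ((∏ i, qPoch (A i * (B j * q ^ s)) q) * ((∏ i ∈ univ.erase j, qPoch (B i / (B j * q ^ s)) q) *
      (qFac (q ^ (-s : ℤ)) q s * qPoch q q))) * (B j * q ^ s) ^ k

theorem qKernelCofactor_pole (hq0 : q ≠ 0) (hp : (qKernelPole q A B).Injective) (j : ι) (s : ℕ) :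
    qKernelCofactor q α β A B k j s (poleSeq q B (j, s)) = qKernelResidue q α β A B k j s := by
  rw [qKernelCofactor, div_poleSeq_self_mul_pow hq0 hp, div_poleSeq_self hp]
  rfl

theorem continuousAt_qKernelCofactor (hq : ‖q‖ < 1) (hq0 : q ≠ 0)
    (hp : (qKernelPole q A B).Injective) (j : ι) (s : ℕ) :
    ContinuousAt (qKernelCofactor q α β A B k j s) (poleSeq q B (j, s)) := by
  have hz := poleSeq_ne_zero hp (j, s)
  have hfac := div_poleSeq_self hp j s
  have hpoch := div_poleSeq_self_mul_pow hq0 hp j s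
  set z := poleSeq q B (j, s)
  have hdiv : ContinuousAt (fun z => B j / z) z := by fun_prop (disch := assumption)
  refine ((differentiableAt_qKernel_numerator hq hz).continuousAt.div (ContinuousAt.mul ?_
    (ContinuousAt.mul ?_ (ContinuousAt.mul ?_ ?_))) (mul_ne_zero ?_ (mul_ne_zero ?_
      (mul_ne_zero ?_ ?_)))).mul (differentiableAt_zpow.2 (Or.inl hz)).continuousAt
  · exact (DifferentiableAt.fun_finsetProd fun _ _ =>
      differentiableAt_qPoch_mul hq _ z).continuousAt
  · exact (DifferentiableAt.fun_finsetProd fun _ _ =>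
      differentiableAt_qPoch_div hq _ hz).continuousAt
  · exact (continuous_qFac q s).continuousAt.comp hdiv
  · exact (continuous_qPoch hq).continuousAt.comp (hdiv.mul continuousAt_const)
  · exact prod_ne_zero_iff.2 fun i _ => qPoch_mul_ne_zero hq fun t ht =>
      Sum.inl_ne_inr (@hp (Sum.inl (j, s)) (Sum.inr (i, t)) ht)
  · refine prod_ne_zero_iff.2 fun i hi => qPoch_div_ne_zero hq hz fun t ht => ?_
    have h := Sum.inl_injective (@hp (Sum.inl (j, s)) (Sum.inl (i, t)) ht)
    exact ne_of_mem_erase hi (congrArg Prod.fst h).symm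
  · exact hfac ▸ qFac_zpow_neg_ne_zero hq hq0 s
  · exact hpoch.symm ▸ qPoch_self_ne_zero hq

theorem tendsto_sub_mul_qKernel_div (hq : ‖q‖ < 1) (hq0 : q ≠ 0)
    (hp : (qKernelPole q A B).Injective) (j : ι) (s : ℕ) :
    Tendsto (fun z => (z - poleSeq q B (j, s)) * (qKernel q α β A B k z / z))
      (𝓝[≠] poleSeq q B (j, s)) (𝓝 (qKernelResidue q α β A B k j s)) := by
  rw [← qKernelCofactor_pole hq0 hp]
  refine ((continuousAt_qKernelCofactor hq hq0 hp j s).tendsto.mono_left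
    nhdsWithin_le_nhds).congr' ?_
  filter_upwards [self_mem_nhdsWithin, nhdsWithin_le_nhds
    (isOpen_ne.mem_nhds (poleSeq_ne_zero hp (j, s)))] with z hz hz0
  have hzp : z - B j * q ^ s ≠ 0 := sub_ne_zero.2 hz
  have hz0' : z ≠ 0 := hz0
  rw [qKernel_eq_mul_cofactor hq hz0 j s, poleSeq]
  field_simp

/-- The residue of `qKernel q α β A B k z / z` at the point `qKernelPole q A B x`. On the right
summand it is read off at `1 / z`, which exchanges the roles of `A` and `B`. -/
def qKernelPoleResidue (q : ℂ) (α β A B : ι → ℂ) (k : ℤ) : (ι × ℕ) ⊕ (ι × ℕ) → ℂ :=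
  Sum.elim (fun x => qKernelResidue q α β A B k x.1 x.2)
    fun x => -qKernelResidue q β α B A (-k) x.1 x.2

theorem tendsto_sub_qKernelPole_mul (hq : ‖q‖ < 1) (hq0 : q ≠ 0)
    (hp : (qKernelPole q A B).Injective) (x : (ι × ℕ) ⊕ (ι × ℕ)) :
    Tendsto (fun z => (z - qKernelPole q A B x) * (qKernel q α β A B k z / z))
      (𝓝[≠] qKernelPole q A B x) (𝓝 (qKernelPoleResidue q α β A B k x)) := by
  rcases x with ⟨j, s⟩ | ⟨j, s⟩
  · exact tendsto_sub_mul_qKernel_div hq hq0 hp j s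
  have hp' := injective_qKernelPole_symm hp
  simp only [qKernelPole, qKernelPoleResidue, Sum.elim_inr]
  set p := poleSeq q A (j, s)
  have hp0 : p ≠ 0 := poleSeq_ne_zero hp' (j, s)
  have hinv : Tendsto (·⁻¹) (𝓝[≠] p⁻¹) (𝓝[≠] p) := by
    refine tendsto_nhdsWithin_iff.2 ⟨?_, ?_⟩
    · simpa using ((tendsto_inv₀ (inv_ne_zero hp0)).mono_left nhdsWithin_le_nhds)
    · filter_upwards [self_mem_nhdsWithin] with z hz h
      exact hz (inv_eq_iff_eq_inv.1 h)
  have h := (((tendsto_sub_mul_qKernel_div (α := β) (β := α) (k := -k) hq hq0 hp' j s).comp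
    hinv).mul ((hinv.mono_right nhdsWithin_le_nhds).div_const p)).neg
  rw [div_self hp0, mul_one] at h
  refine h.congr' ?_
  filter_upwards [nhdsWithin_le_nhds (isOpen_ne.mem_nhds (inv_ne_zero hp0))] with z hz
  have hz' : z ≠ 0 := hz
  simp only [Function.comp_apply, ← qKernel_inv, inv_inv]
  change -((z⁻¹ - p) * _ * _) = _
  field_simp
  ring

end Residue

/-- The quotient of the values of `qKernel q α β A B k` at `q z` and at `z`. -/
def qKernelRatio (q : ℂ) (α β A B : ι → ℂ) (k : ℤ) (z : ℂ) : ℂ :=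
  (∏ i, (q * z - α i) * (1 - A i * z) / ((q * z - B i) * (1 - β i * z))) * q ^ k

theorem qPoch_div_mul_left (hq : ‖q‖ < 1) (hq0 : q ≠ 0) {z : ℂ} (hz : z ≠ 0) (c : ℂ) :
    qPoch (c / (q * z)) q = (q * z - c) / (q * z) * qPoch (c / z) q := by
  rw [qPoch_eq_one_sub_mul hq]
  congr 2 <;> field_simp

theorem qPoch_mul_left (hq : ‖q‖ < 1) (c z : ℂ) :
    qPoch (c * z) q = (1 - c * z) * qPoch (c * (q * z)) q := by
  rw [qPoch_eq_one_sub_mul hq, mul_left_comm]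

theorem qKernel_mul_left (hq : ‖q‖ < 1) (hq0 : q ≠ 0) {z : ℂ} (hz : z ≠ 0)
    (hA : ∀ i, 1 - A i * z ≠ 0) (hβ : ∀ i, 1 - β i * z ≠ 0) :
    qKernel q α β A B k (q * z) = qKernelRatio q α β A B k z * qKernel q α β A B k z := by
  have hfac : ∀ i, qPoch (α i / (q * z)) q * qPoch (β i * (q * z)) q /
      (qPoch (A i * (q * z)) q * qPoch (B i / (q * z)) q) =
      (q * z - α i) * (1 - A i * z) / ((q * z - B i) * (1 - β i * z)) *
        (qPoch (α i / z) q * qPoch (β i * z) q / (qPoch (A i * z) q * qPoch (B i / z) q)) :=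
      fun i => by
    rw [qPoch_div_mul_left hq hq0 hz, qPoch_div_mul_left hq hq0 hz, qPoch_mul_left hq (β i) z,
      qPoch_mul_left hq (A i) z]
    have := hA i
    have := hβ i
    generalize 1 - A i * z = x at *
    generalize 1 - β i * z = y at *
    generalize q * z - B i = u
    generalize q * z - α i = v
    field_simp
  simp only [qKernel, qKernelRatio, ← prod_mul_distrib, ← prod_div_distrib, hfac]
  rw [prod_mul_distrib, mul_zpow]
  ring

theorem tendsto_qKernelRatio (hB : ∀ i, B i ≠ 0) :
    Tendsto (qKernelRatio q α β A B k) (𝓝 0) (𝓝 ((∏ i, α i / B i) * q ^ k)) := by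
  have hc : ContinuousAt (qKernelRatio q α β A B k) 0 :=
    ContinuousAt.mul (tendsto_finsetProd _ fun i _ => ContinuousAt.div (by fun_prop)
      (by fun_prop) (by simp [hB i])) continuousAt_const
  simpa [qKernelRatio, neg_div_neg_eq] using hc.tendsto

theorem eventually_norm_qKernel_mul_left_le (hq : ‖q‖ < 1) (hq0 : q ≠ 0) (hB : ∀ i, B i ≠ 0)
    {t : ℝ} (ht : ‖(∏ i, α i / B i) * q ^ k‖ < t) :
    ∀ᶠ ρ in 𝓝[>] (0 : ℝ), ∀ z : ℂ, z ≠ 0 → ‖z‖ ≤ ρ →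
      ‖qKernel q α β A B k (q * z)‖ ≤ t * ‖qKernel q α β A B k z‖ := by
  have hne : ∀ c : ι → ℂ, ∀ᶠ z in 𝓝 (0 : ℂ), ∀ i, 1 - c i * z ≠ 0 := fun c =>
    eventually_all.2 fun i => ContinuousAt.eventually_ne (by fun_prop) (by simp)
  obtain ⟨δ, hδ, h⟩ := Metric.eventually_nhds_iff.1
    (((tendsto_qKernelRatio (β := β) (A := A) hB).norm.eventually_lt_const ht).and
      ((hne A).and (hne β)))
  filter_upwards [Ioo_mem_nhdsGT hδ] with ρ hρ z hz hzρ
  obtain ⟨hlt, hA, hβ⟩ := h (y := z) (by simpa using hzρ.trans_lt hρ.2)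
  rw [qKernel_mul_left hq hq0 hz hA hβ, norm_mul]
  gcongr

theorem norm_pow_mul_le_of_norm_mul_left_le {f : ℂ → ℂ} {t ρ : ℝ} (hq : ‖q‖ < 1) (hq0 : q ≠ 0)
    (ht : 0 ≤ t) (h : ∀ z : ℂ, z ≠ 0 → ‖z‖ ≤ ρ → ‖f (q * z)‖ ≤ t * ‖f z‖) {z : ℂ} (hz : z ≠ 0)
    (hzρ : ‖z‖ ≤ ρ) (n : ℕ) : ‖f (q ^ n * z)‖ ≤ t ^ n * ‖f z‖ := by
  induction n with
  | zero => simp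
  | succ n ih =>
    rw [pow_succ', mul_assoc, pow_succ', mul_assoc]
    refine (h _ (mul_ne_zero (pow_ne_zero _ hq0) hz) ?_).trans (by gcongr)
    rw [norm_mul, norm_pow]
    exact (mul_le_of_le_one_left (norm_nonneg _) (pow_le_one₀ (norm_nonneg _) hq.le)).trans hzρ

theorem tendsto_circleIntegral_div_of_norm_mul_left_le {f : ℂ → ℂ} {t ρ : ℝ} (hq : ‖q‖ < 1)
    (hq0 : q ≠ 0) (ht : 0 ≤ t) (ht1 : t < 1) (hρ : 0 < ρ)
    (h : ∀ z : ℂ, z ≠ 0 → ‖z‖ ≤ ρ → ‖f (q * z)‖ ≤ t * ‖f z‖)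
    (hf : ContinuousOn f (Metric.sphere 0 ρ)) :
    Tendsto (fun n : ℕ => ∮ z in C(0, ρ * ‖q‖ ^ n), f z / z) atTop (𝓝 0) := by
  obtain ⟨C, hC⟩ := (isCompact_sphere (0 : ℂ) ρ).exists_bound_of_continuousOn hf
  have hqn : ∀ n : ℕ, 0 < ‖q‖ ^ n := fun n => pow_pos (norm_pos_iff.2 hq0) n
  have hbound : ∀ n : ℕ, ‖∮ z in C(0, ρ * ‖q‖ ^ n), f z / z‖ ≤ 2 * Real.pi * C * t ^ n :=
      fun n => by
    have hρn : 0 < ρ * ‖q‖ ^ n := mul_pos hρ (hqn n)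
    refine (circleIntegral.norm_integral_le_of_norm_le_const hρn.le
      (C := t ^ n * C / (ρ * ‖q‖ ^ n)) fun z hz => ?_).trans_eq (by field_simp)
    have hz' : ‖z‖ = ρ * ‖q‖ ^ n := by simpa using hz
    have hwρ : ‖z / q ^ n‖ = ρ := by
      rw [norm_div, norm_pow, hz', mul_div_cancel_right₀ _ (hqn n).ne']
    have hle := norm_pow_mul_le_of_norm_mul_left_le hq hq0 ht h
      (norm_pos_iff.1 (hwρ ▸ hρ)) hwρ.le n
    rw [mul_div_cancel₀ _ (pow_ne_zero n hq0)] at hle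
    rw [norm_div, hz']
    gcongr
    exact hle.trans (by gcongr; exact hC _ (by simpa using hwρ))
  refine squeeze_zero_norm hbound ?_
  simpa using (tendsto_pow_atTop_nhds_zero_of_lt_one ht ht1).const_mul (2 * Real.pi * C)

theorem eventually_tendsto_circleIntegral_qKernel (hq : ‖q‖ < 1) (hq0 : q ≠ 0)
    (hp : (qKernelPole q A B).Injective) (hk : ‖(∏ i, α i / B i) * q ^ k‖ < 1) :
    ∀ᶠ ρ in 𝓝[>] (0 : ℝ), (∀ x, ‖poleSeq q B x‖ ≠ ρ) →
      Tendsto (fun n : ℕ => ∮ z in C(0, ρ * ‖q‖ ^ n), qKernel q α β A B k z / z) atTop (𝓝 0) := by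
  obtain ⟨t, ht, ht1⟩ := exists_between hk
  have hB : ∀ i, B i ≠ 0 := fun i => left_ne_zero_of_mul (poleSeq_ne_zero hp (i, 0))
  filter_upwards [eventually_norm_qKernel_mul_left_le hq hq0 hB ht,
    eventually_lt_norm_inv_poleSeq hq hp, self_mem_nhdsWithin] with ρ hle hA hρ hBρ
  refine tendsto_circleIntegral_div_of_norm_mul_left_le hq hq0 ((norm_nonneg _).trans ht.le) ht1 hρ
    hle fun z hz => ?_
  have hz' : ‖z‖ = ρ := by simpa using hz
  refine (differentiableAt_qKernel hq (norm_pos_iff.1 (hz' ▸ hρ))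
    ?_).continuousAt.continuousWithinAt
  rintro ⟨x | x, rfl⟩
  · exact hBρ x hz'
  · exact (hA x).ne' hz'

variable [DecidableEq ι]

/-- The poles of `qKernel q α β A B k z / z` that tend to the origin. A point `B i * q ^ s` where
a zero of the numerator cancels that of the denominator is not among them. -/
def qKernelInnerPoles (q : ℂ) (α β A B : ι → ℂ) (k : ℤ) : Set ℂ :=
  poleSeq q B '' {x | qKernelResidue q α β A B k x.1 x.2 ≠ 0}

/-- The poles of `qKernel q α β A B k z / z` that tend to infinity, read off at `1 / z`. -/
def qKernelOuterPoles (q : ℂ) (α β A B : ι → ℂ) (k : ℤ) : Set ℂ :=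
  Inv.inv ⁻¹' qKernelInnerPoles q β α B A (-k)

section Contour

variable {x : ℂ} {γ : Path x x}

theorem IsSeparatingContour.windingNumber_poleSeq
    (h : IsSeparatingContour γ (qKernelInnerPoles q α β A B k) (qKernelOuterPoles q α β A B k))
    {y : ι × ℕ} (hy : qKernelResidue q α β A B k y.1 y.2 ≠ 0) :
    poleSeq q B y ∉ Set.range γ ∧ windingNumber γ (poleSeq q B y) = 1 :=
  h.inside _ (Or.inr ⟨y, hy, rfl⟩)

theorem IsSeparatingContour.windingNumber_inv_poleSeq
    (h : IsSeparatingContour γ (qKernelInnerPoles q α β A B k) (qKernelOuterPoles q α β A B k))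
    {y : ι × ℕ} (hy : qKernelResidue q β α B A (-k) y.1 y.2 ≠ 0) :
    (poleSeq q A y)⁻¹ ∉ Set.range γ ∧ windingNumber γ (poleSeq q A y)⁻¹ = 0 :=
  h.outside _ ⟨y, hy, (inv_inv _).symm⟩

theorem IsSeparatingContour.qKernelPole_notMem_range
    (h : IsSeparatingContour γ (qKernelInnerPoles q α β A B k) (qKernelOuterPoles q α β A B k))
    {y : (ι × ℕ) ⊕ (ι × ℕ)} (hy : qKernelPoleResidue q α β A B k y ≠ 0) :
    qKernelPole q A B y ∉ Set.range γ := by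
  rcases y with y | y
  · exact (h.windingNumber_poleSeq hy).1
  · exact (h.windingNumber_inv_poleSeq (neg_ne_zero.1 hy)).1

theorem IsSeparatingContour.qKernelPoleResidue_mul_windingNumber
    (h : IsSeparatingContour γ (qKernelInnerPoles q α β A B k) (qKernelOuterPoles q α β A B k))
    {ρ : ℝ} (hB : ∀ y, ‖poleSeq q B y‖ ≠ ρ) (hA : ∀ y, ρ < ‖(poleSeq q A y)⁻¹‖)
    (y : (ι × ℕ) ⊕ (ι × ℕ)) :
    qKernelPoleResidue q α β A B k y * (windingNumber γ (qKernelPole q A B y) -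
        windingNumber γ 0 * if ‖qKernelPole q A B y‖ < ρ then 1 else 0) =
      Sum.elim (fun y => if ρ < ‖poleSeq q B y‖ then qKernelResidue q α β A B k y.1 y.2 else 0)
        (fun _ => 0) y := by
  rcases y with y | y
  · simp only [qKernelPoleResidue, qKernelPole, Sum.elim_inl, (h.inside 0 (Or.inl rfl)).2]
    by_cases hy : qKernelResidue q α β A B k y.1 y.2 = 0
    · simp [hy]
    rw [(h.windingNumber_poleSeq hy).2]
    rcases (hB y).lt_or_gt with hlt | hlt <;> simp [hlt, hlt.not_gt]
  · simp only [qKernelPoleResidue, qKernelPole, Sum.elim_inr, (hA y).not_gt, if_false, mul_zero,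
      sub_zero]
    by_cases hy : qKernelResidue q β α B A (-k) y.1 y.2 = 0
    · simp [hy]
    rw [(h.windingNumber_inv_poleSeq hy).2, mul_zero]

theorem IsSeparatingContour.sum_qKernelPoleResidue_mul_windingNumber
    (h : IsSeparatingContour γ (qKernelInnerPoles q α β A B k) (qKernelOuterPoles q α β A B k))
    {ρ : ℝ} (hB : ∀ y, ‖poleSeq q B y‖ ≠ ρ) (hA : ∀ y, ρ < ‖(poleSeq q A y)⁻¹‖)
    {s : Finset ((ι × ℕ) ⊕ (ι × ℕ))} {t : Finset (ι × ℕ)} (hts : t.map .inl ⊆ s)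
    (ht : ∀ y, y ∈ t ↔ ρ < ‖poleSeq q B y‖) :
    ∑ y ∈ s, qKernelPoleResidue q α β A B k y * (windingNumber γ (qKernelPole q A B y) -
        windingNumber γ 0 * if ‖qKernelPole q A B y‖ < ρ then 1 else 0) =
      ∑ y ∈ t, qKernelResidue q α β A B k y.1 y.2 := by
  simp only [h.qKernelPoleResidue_mul_windingNumber hB hA]
  rw [← sum_subset hts, sum_map]
  · exact sum_congr rfl fun y hy => if_pos ((ht y).1 hy)
  · rintro (y | y) - hy
    · exact if_neg fun hρ => hy (mem_map.2 ⟨y, (ht y).2 hρ, rfl⟩)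
    · rfl

theorem contourIntegral_qKernel_eq_circleIntegral_add (hq : ‖q‖ < 1) (hq0 : q ≠ 0)
    (hp : (qKernelPole q A B).Injective)
    (h : IsSeparatingContour γ (qKernelInnerPoles q α β A B k) (qKernelOuterPoles q α β A B k))
    {ρ : ℝ} (hρ : 0 < ρ) (hγ : ∀ t, ρ < ‖γ t‖) (hB : ∀ y, ‖poleSeq q B y‖ ≠ ρ)
    (hA : ∀ y, ρ < ‖(poleSeq q A y)⁻¹‖) :
    contourIntegral (fun z => qKernel q α β A B k z / z) γ =
      (∮ z in C(0, ρ), qKernel q α β A B k z / z) + 2 * Real.pi * Complex.I *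
        ∑ y ∈ (finite_lt_norm_poleSeq hq B hρ).toFinset,
          qKernelResidue q α β A B k y.1 y.2 := by
  obtain ⟨C, hC⟩ := (isCompact_range γ.continuous).isBounded.exists_norm_le
  set R := max (max C ρ) (∑ i, ‖B i‖) + 1
  have hCR : C < R := by grind
  have hρR : ρ < R := by grind
  have hBR : ∀ y, ‖poleSeq q B y‖ < R := fun y => by
    have := norm_poleSeq_le hq B y
    grind
  set s := (finite_qKernelPole_preimage_annulus (R := R) hq A B (half_pos hρ)).toFinset
  have hs : ∀ y, y ∈ s ↔ qKernelPole q A B y ∈ annulus (ρ / 2) R := fun y => by simp [s]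
  have hdiff : DifferentiableOn ℂ (fun z => qKernel q α β A B k z / z)
      (annulus (ρ / 2) R \ qKernelPole q A B '' s) := fun z ⟨hz, hzs⟩ => by
    have hz0 : z ≠ 0 := norm_pos_iff.1 ((half_pos hρ).trans hz.1)
    refine ((differentiableAt_qKernel hq hz0 ?_).div differentiableAt_id
      hz0).differentiableWithinAt
    rintro ⟨y, rfl⟩
    exact hzs ⟨y, (hs y).2 hz, rfl⟩
  have hpρ : ∀ y ∈ s, ‖qKernelPole q A B y‖ ≠ ρ := by
    rintro (y | y) -
    exacts [hB y, (hA y).ne']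
  rw [contourIntegral_eq_circleIntegral_add (half_pos hρ) ⟨half_lt_self hρ, hρR⟩ hp.injOn
    (fun y hy => (hs y).1 hy) hdiff (fun y _ => tendsto_sub_qKernelPole_mul hq hq0 hp y) hpρ
    h.piecewiseC1 ?_ (fun y _ => h.qKernelPole_notMem_range),
    h.sum_qKernelPoleResidue_mul_windingNumber hB hA ?_ fun y => Set.Finite.mem_toFinset _,
    (h.inside 0 (Or.inl rfl)).2, one_mul]
  · intro y hy
    obtain ⟨y', hy', rfl⟩ := mem_map.1 hy
    exact (hs _).2 ⟨(half_lt_self hρ).trans ((finite_lt_norm_poleSeq hq B hρ).mem_toFinset.1 hy'),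
      hBR y'⟩
  · rintro _ ⟨t, rfl⟩
    exact ⟨(half_lt_self hρ).trans (hγ t), (hC _ ⟨t, rfl⟩).trans_lt hCR⟩

theorem contourIntegral_qKernel_eq (hq : ‖q‖ < 1) (hq0 : q ≠ 0)
    (hp : (qKernelPole q A B).Injective) (hk : ‖(∏ i, α i / B i) * q ^ k‖ < 1)
    (h : IsSeparatingContour γ (qKernelInnerPoles q α β A B k) (qKernelOuterPoles q α β A B k))
    {S : ℂ} (hS : HasSum (fun y : ι × ℕ => qKernelResidue q α β A B k y.1 y.2) S) :
    contourIntegral (fun z => qKernel q α β A B k z / z) γ = 2 * Real.pi * Complex.I * S := by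
  have hγ : ∀ᶠ ρ in 𝓝[>] (0 : ℝ), ∀ t, ρ < ‖γ t‖ := by
    obtain ⟨ε, hε, hsub⟩ := Metric.isOpen_iff.1
      (isCompact_range γ.continuous).isClosed.isOpen_compl 0 (h.inside 0 (Or.inl rfl)).1
    filter_upwards [Ioo_mem_nhdsGT hε] with ρ hρ t
    by_contra! hle
    exact hsub (mem_ball_zero_iff.2 (hle.trans_lt hρ.2)) ⟨t, rfl⟩
  obtain ⟨δ, hδ, hgood⟩ := mem_nhdsGT_iff_exists_Ioo_subset.1
    (hγ.and ((eventually_lt_norm_inv_poleSeq hq hp).and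
      (eventually_tendsto_circleIntegral_qKernel (α := α) (β := β) hq hq0 hp hk)))
  obtain ⟨ρ, hρ, hB⟩ := exists_Ioo_forall_norm_poleSeq_ne hq0 B hδ
  obtain ⟨hγρ, hAρ, hlim⟩ := hgood hρ
  have hq' := norm_pos_iff.2 hq0
  have hρn : ∀ n : ℕ, 0 < ρ * ‖q‖ ^ n := fun n => mul_pos hρ.1 (pow_pos hq' n)
  have hρle : ∀ n : ℕ, ρ * ‖q‖ ^ n ≤ ρ := fun n =>
    mul_le_of_le_one_right hρ.1.le (pow_le_one₀ hq'.le hq.le)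
  have hT := tendsto_toFinset_lt_norm_poleSeq hq B (poleSeq_ne_zero hp) hρn
    (by simpa using (tendsto_pow_atTop_nhds_zero_of_lt_one hq'.le hq).const_mul ρ)
  have hsum : ∀ n, contourIntegral (fun z => qKernel q α β A B k z / z) γ =
      (∮ z in C(0, ρ * ‖q‖ ^ n), qKernel q α β A B k z / z) +
        2 * Real.pi * Complex.I * ∑ y ∈ (finite_lt_norm_poleSeq hq B (hρn n)).toFinset,
           qKernelResidue q α β A B k y.1 y.2 := fun n =>
    contourIntegral_qKernel_eq_circleIntegral_add hq hq0 hp h (hρn n)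
      (fun t => (hρle n).trans_lt (hγρ t)) (hB n) fun y => (hρle n).trans_lt (hAρ y)
  refine tendsto_nhds_unique (tendsto_const_nhds (f := atTop))
    (Tendsto.congr (fun n => (hsum n).symm) ?_)
  simpa using (hlim (by simpa using hB 0)).add ((hS.comp hT).const_mul (2 * Real.pi * Complex.I))

end Contour

end QKernel

section Saalschutz

open Filter Topology Finset

variable {q : ℂ}

section Saalschutz

/-- The factor `(qz/u, qz/v, yz; q)_∞ / (αz, βz; q)_∞` of the terms of a nonterminating `₃φ₂`
series, which runs over `z = u q^n`. -/
def saalWeight (q u v α β y z : ℂ) : ℂ :=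
  qPoch (q * z / u) q * qPoch (q * z / v) q * qPoch (y * z) q /
    (qPoch (α * z) q * qPoch (β * z) q)

/-- The terms of a nonterminating balanced `₃φ₂` series with argument `q`. The normalization keeps
them finite for all `x`, including the zeros of `(xu; q)_∞`, where the series terminates. -/
def saalTerm (q u v α β x : ℂ) (n : ℕ) : ℂ :=
  u * q ^ n * saalWeight q u v α β (α * β * u * v * x) (u * q ^ n) * qFac (x * u) q n

/-- The partial sums of the series in the contiguous relation for `saalTerm`. -/
def saalSum (q u v α β x : ℂ) (n : ℕ) : ℂ :=
  -(x * u * v) * saalWeight q u v (q * α) (q * β) (q * (α * β * u * v * x)) (u * q ^ n) *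
    qFac (q * x * u) q n

theorem exists_norm_inv_qPoch_mul_pow_le (hq : ‖q‖ < 1) (x : ℂ) :
    ∃ C, ∀ n : ℕ, ‖(qPoch (x * q ^ n) q)⁻¹‖ ≤ C := by
  have h := (tendsto_qPoch_mul_pow hq x).inv₀ one_ne_zero
  obtain ⟨C, hC⟩ := (Metric.isBounded_range_of_tendsto _ h).exists_norm_le
  exact ⟨C, fun n => hC _ ⟨n, rfl⟩⟩

theorem exists_norm_saalWeight_le (hq : ‖q‖ < 1) (u v α β : ℂ) (t : ℝ) :
    ∃ C, ∀ y : ℂ, ‖y‖ ≤ t → ∀ n : ℕ, ‖saalWeight q u v α β y (u * q ^ n)‖ ≤ C := by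
  obtain ⟨Cα, hα⟩ := exists_norm_inv_qPoch_mul_pow_le hq (α * u)
  obtain ⟨Cβ, hβ⟩ := exists_norm_inv_qPoch_mul_pow_le hq (β * u)
  refine ⟨qBound ‖q * u / u‖ q * qBound ‖q * u / v‖ q * qBound (t * ‖u‖) q * (Cα * Cβ),
    fun y hy n => ?_⟩
  have hqn : ‖q ^ n‖ ≤ 1 := by
    rw [norm_pow]; exact pow_le_one₀ (norm_nonneg _) hq.le
  have bound : ∀ {w : ℂ} {s : ℝ}, ‖w‖ ≤ s → ‖qPoch (w * q ^ n) q‖ ≤ qBound s q := fun {w s} hw =>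
    norm_qPoch_le hq (by
      rw [norm_mul]; exact (mul_le_of_le_one_right (norm_nonneg _) hqn).trans hw)
  have hyu : ‖y * u‖ ≤ t * ‖u‖ := by rw [norm_mul]; gcongr
  rw [saalWeight, show q * (u * q ^ n) / u = q * u / u * q ^ n by ring,
    show q * (u * q ^ n) / v = q * u / v * q ^ n by ring, ← mul_assoc, ← mul_assoc, ← mul_assoc,
    div_eq_mul_inv, mul_inv, norm_mul, norm_mul, norm_mul, norm_mul]
  have hB : ∀ s, 0 ≤ qBound s q := fun s => (Real.exp_pos _).le
  have hCα := (norm_nonneg _).trans (hα 0)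
  gcongr
  · exact mul_nonneg (mul_nonneg (hB _) (hB _)) (hB _)
  · exact mul_nonneg (hB _) (hB _)
  · exact hB _
  · exact bound le_rfl
  · exact bound le_rfl
  · exact bound hyu
  · exact hα n
  · exact hβ n

theorem exists_norm_saalTerm_le (hq : ‖q‖ < 1) (u v α β : ℂ) (t : ℝ) :
    ∃ C, ∀ x : ℂ, ‖x‖ ≤ t → ∀ n, ‖saalTerm q u v α β x n‖ ≤ C * ‖q‖ ^ n := by
  obtain ⟨C, hC⟩ := exists_norm_saalWeight_le hq u v α β (‖α * β * u * v‖ * t)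
  refine ⟨‖u‖ * C * qBound (t * ‖u‖) q, fun x hx n => ?_⟩
  have hW := hC (α * β * u * v * x) (by rw [norm_mul]; gcongr) n
  have hF : ‖qFac (x * u) q n‖ ≤ qBound (t * ‖u‖) q :=
    norm_qFac_le hq (by rw [norm_mul]; gcongr) n
  have hC0 := (norm_nonneg _).trans hW
  calc ‖saalTerm q u v α β x n‖
      = ‖u‖ * ‖q‖ ^ n * ‖saalWeight q u v α β (α * β * u * v * x) (u * q ^ n)‖ *
          ‖qFac (x * u) q n‖ := by
        rw [saalTerm, norm_mul, norm_mul, norm_mul, norm_pow]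
    _ ≤ ‖u‖ * ‖q‖ ^ n * C * qBound (t * ‖u‖) q := by gcongr
    _ = ‖u‖ * C * qBound (t * ‖u‖) q * ‖q‖ ^ n := by ring

theorem summable_saalTerm (hq : ‖q‖ < 1) (u v α β x : ℂ) : Summable (saalTerm q u v α β x) := by
  obtain ⟨C, hC⟩ := exists_norm_saalTerm_le hq u v α β ‖x‖
  exact Summable.of_norm_bounded
    ((summable_geometric_of_lt_one (norm_nonneg q) hq).mul_left C) (hC x le_rfl)

theorem tendsto_saalWeight_mul_pow (hq : ‖q‖ < 1) (u v α β y z : ℂ) :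
    Tendsto (fun n : ℕ => saalWeight q u v α β y (z * q ^ n)) atTop (𝓝 1) := by
  have h : ∀ c : ℂ, Tendsto (fun n : ℕ => qPoch (c * q ^ n) q) atTop (𝓝 1) :=
    tendsto_qPoch_mul_pow hq
  have := (((h (q * z / u)).mul (h (q * z / v))).mul (h (y * z))).div
    ((h (α * z)).mul (h (β * z))) (by simp)
  simp only [mul_one, div_one] at this
  refine this.congr fun n => ?_
  simp only [saalWeight, Pi.div_apply]
  ring_nf

theorem tendsto_saalSum (hq : ‖q‖ < 1) (u v α β x : ℂ) :
    Tendsto (saalSum q u v α β x) atTop (𝓝 (-(x * u * v) * qPoch (q * x * u) q)) := by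
  have := ((tendsto_saalWeight_mul_pow hq u v (q * α) (q * β) (q * (α * β * u * v * x))
    u).const_mul (-(x * u * v))).mul (tendsto_qFac hq (q * x * u))
  simpa only [mul_one] using! this

theorem saalWeight_eq_mul_saalWeight (hq : ‖q‖ < 1) (u v α β y z : ℂ) :
    saalWeight q u v α β y z =
      (1 - y * z) / ((1 - α * z) * (1 - β * z)) * saalWeight q u v (q * α) (q * β) (q * y) z := by
  simp only [saalWeight, mul_assoc]
  rw [qPoch_eq_one_sub_mul hq (y * z), qPoch_eq_one_sub_mul hq (α * z),
    qPoch_eq_one_sub_mul hq (β * z)]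
  simp only [div_eq_mul_inv, mul_inv]
  ring

theorem saalWeight_mul_left (hq : ‖q‖ < 1) (u v α β y z : ℂ) :
    saalWeight q u v α β (q * y) z =
      ((1 - α * z) * (1 - β * z))⁻¹ * saalWeight q u v (q * α) (q * β) (q * y) z := by
  simp only [saalWeight, mul_assoc]
  rw [qPoch_eq_one_sub_mul hq (α * z), qPoch_eq_one_sub_mul hq (β * z)]
  simp only [div_eq_mul_inv, mul_inv]
  ring

theorem saalWeight_eq_mul_saalWeight_mul (hq : ‖q‖ < 1) (u v α β y z : ℂ) :
    saalWeight q u v (q * α) (q * β) (q * y) z = (1 - q * z / u) * (1 - q * z / v) *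
      (1 - y * (q * z)) / ((1 - α * (q * z)) * (1 - β * (q * z))) *
      saalWeight q u v (q * α) (q * β) (q * y) (q * z) := by
  have hc : ∀ c : ℂ, q * c * z = c * (q * z) := fun c => by ring
  have hc' : ∀ c : ℂ, q * (c * (q * z)) = q * c * (q * z) := fun c => by ring
  have hd : ∀ c : ℂ, q * (q * z / c) = q * (q * z) / c := fun c => by ring
  simp only [saalWeight]
  rw [qPoch_eq_one_sub_mul hq (q * z / u), qPoch_eq_one_sub_mul hq (q * z / v),
    hc α, hc β, hc y, qPoch_eq_one_sub_mul hq (α * (q * z)), qPoch_eq_one_sub_mul hq (β * (q * z)),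
    qPoch_eq_one_sub_mul hq (y * (q * z)), hc' α, hc' β, hc' y, hd u, hd v]
  simp only [div_eq_mul_inv, mul_inv]
  ring

theorem saalTerm_contiguous_zero (hq : ‖q‖ < 1) {u v α β x : ℂ} (hα : α * u ≠ 1)
    (hβ : β * u ≠ 1) :
    (1 - x * v) * saalTerm q u v α β x 0 -
      (1 - x * α * u * v) * (1 - x * β * u * v) * saalTerm q u v α β (q * x) 0 =
      saalSum q u v α β x 0 := by
  simp only [saalTerm, saalSum, pow_zero, mul_one, qFac_zero]
  rw [show α * β * u * v * (q * x) = q * (α * β * u * v * x) by ring, saalWeight_mul_left hq,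
    saalWeight_eq_mul_saalWeight hq u v α β]
  have hinv : (1 - α * u) * (1 - β * u) * ((1 - α * u) * (1 - β * u))⁻¹ = 1 :=
    mul_inv_cancel₀ (mul_ne_zero (sub_ne_zero.2 hα.symm) (sub_ne_zero.2 hβ.symm))
  linear_combination -(x * u * v) *
    saalWeight q u v (q * α) (q * β) (q * (α * β * u * v * x)) u * hinv

theorem saalTerm_contiguous_succ (hq : ‖q‖ < 1) {u v α β x : ℂ} (hu : u ≠ 0) (hv : v ≠ 0) (n : ℕ)
    (hα : α * (u * q ^ (n + 1)) ≠ 1) (hβ : β * (u * q ^ (n + 1)) ≠ 1) :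
    (1 - x * v) * saalTerm q u v α β x (n + 1) -
      (1 - x * α * u * v) * (1 - x * β * u * v) * saalTerm q u v α β (q * x) (n + 1) =
      saalSum q u v α β x (n + 1) - saalSum q u v α β x n := by
  simp only [saalTerm, saalSum]
  rw [show α * β * u * v * (q * x) = q * (α * β * u * v * x) by ring, saalWeight_mul_left hq,
    saalWeight_eq_mul_saalWeight hq u v α β (α * β * u * v * x),
    saalWeight_eq_mul_saalWeight_mul hq u v α β (α * β * u * v * x) (u * q ^ n),
    show q * (u * q ^ n) = u * q ^ (n + 1) by ring, qFac_succ' (x * u),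
    ← mul_assoc q x, qFac_succ (q * x * u),
    show q * x * u * q ^ n = x * (u * q ^ (n + 1)) by ring]
  generalize u * q ^ (n + 1) = z at *
  generalize saalWeight q u v (q * α) (q * β) (q * (α * β * u * v * x)) z = W
  have hinv : (1 - α * z) * (1 - β * z) * ((1 - α * z) * (1 - β * z))⁻¹ = 1 :=
    mul_inv_cancel₀ (mul_ne_zero (sub_ne_zero.2 hα.symm) (sub_ne_zero.2 hβ.symm))
  have huv : u * v * ((1 - z / u) * (1 - z / v)) = (u - z) * (v - z) := by field_simp
  linear_combination -(x * u * v * (1 - x * z) * W * qFac (q * x * u) q n) * hinv +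
    x * (1 - α * β * u * v * x * z) * ((1 - α * z) * (1 - β * z))⁻¹ * W *
      qFac (q * x * u) q n * -huv

theorem tsum_saalTerm_contiguous (hq : ‖q‖ < 1) {u v α β : ℂ} (x : ℂ) (hu : u ≠ 0) (hv : v ≠ 0)
    (hα : ∀ n : ℕ, α * (u * q ^ n) ≠ 1) (hβ : ∀ n : ℕ, β * (u * q ^ n) ≠ 1) :
    (1 - x * v) * ∑' n, saalTerm q u v α β x n -
      (1 - x * α * u * v) * (1 - x * β * u * v) * ∑' n, saalTerm q u v α β (q * x) n =
      -(x * u * v) * qPoch (q * x * u) q := by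
  have h := ((summable_saalTerm hq u v α β x).hasSum.mul_left (1 - x * v)).sub
    ((summable_saalTerm hq u v α β (q * x)).hasSum.mul_left
      ((1 - x * α * u * v) * (1 - x * β * u * v)))
  refine tendsto_nhds_unique (h.tendsto_sum_nat.comp (tendsto_add_atTop_nat 1)) ?_
  refine (tendsto_saalSum hq u v α β x).congr fun n => ?_
  induction n with
  | zero =>
    simp [← saalTerm_contiguous_zero hq (x := x) (by simpa using hα 0) (by simpa using hβ 0)]
  | succ n ih =>
    simp only [Function.comp] at ih ⊢
    rw [sum_range_succ, ← ih, saalTerm_contiguous_succ hq hu hv n (hα _) (hβ _)]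
    ring

theorem tendsto_tsum_saalTerm_mul_pow (hq : ‖q‖ < 1) (u v α β x : ℂ) :
    Tendsto (fun n : ℕ => ∑' k, saalTerm q u v α β (x * q ^ n) k) atTop
      (𝓝 (∑' k, saalTerm q u v α β 0 k)) := by
  obtain ⟨C, hC⟩ := exists_norm_saalTerm_le hq u v α β ‖x‖
  refine tendsto_tsum_of_dominated_convergence (bound := fun k => C * ‖q‖ ^ k)
    ((summable_geometric_of_lt_one (norm_nonneg q) hq).mul_left C) (fun k => ?_)
    (Eventually.of_forall fun n k => hC _ ?_ k)
  · have hc : Continuous fun y => saalTerm q u v α β y k := by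
      have := continuous_qPoch hq
      unfold saalTerm saalWeight qFac
      fun_prop
    exact (hc.tendsto 0).comp (tendsto_mul_pow hq x)
  · rw [norm_mul, norm_pow]
    exact mul_le_of_le_one_right (norm_nonneg _) (pow_le_one₀ (norm_nonneg _) hq.le)

/-- The difference of two nonterminating balanced `₃φ₂` series, normalized so that it satisfies a
homogeneous first-order `q`-difference equation in `x`. -/
def saalDiff (q u v α β x : ℂ) : ℂ :=
  qPoch (x * v) q * ∑' n, saalTerm q u v α β x n - qPoch (x * u) q * ∑' n, saalTerm q v u α β x n

theorem tendsto_saalDiff_mul_pow (hq : ‖q‖ < 1) (u v α β x : ℂ) :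
    Tendsto (fun n : ℕ => saalDiff q u v α β (x * q ^ n)) atTop (𝓝 (saalDiff q u v α β 0)) := by
  have hP : ∀ w : ℂ, Tendsto (fun n : ℕ => qPoch (x * q ^ n * w) q) atTop
      (𝓝 (qPoch (0 * w) q)) := fun w =>
    ((continuous_qPoch hq).tendsto _).comp ((tendsto_mul_pow hq x).mul_const w)
  exact ((hP v).mul (tendsto_tsum_saalTerm_mul_pow hq u v α β x)).sub
    ((hP u).mul (tendsto_tsum_saalTerm_mul_pow hq v u α β x))

variable {u v α β : ℂ}

theorem saalDiff_eq_mul_saalDiff (hq : ‖q‖ < 1) (x : ℂ) (hu : u ≠ 0) (hv : v ≠ 0)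
    (hαu : ∀ n : ℕ, α * (u * q ^ n) ≠ 1) (hβu : ∀ n : ℕ, β * (u * q ^ n) ≠ 1)
    (hαv : ∀ n : ℕ, α * (v * q ^ n) ≠ 1) (hβv : ∀ n : ℕ, β * (v * q ^ n) ≠ 1) :
    saalDiff q u v α β x =
      (1 - x * α * u * v) * (1 - x * β * u * v) * saalDiff q u v α β (q * x) := by
  have h1 := tsum_saalTerm_contiguous hq x hu hv hαu hβu
  have h2 := tsum_saalTerm_contiguous hq x hv hu hαv hβv
  simp only [saalDiff]
  rw [qPoch_eq_one_sub_mul hq (x * u), qPoch_eq_one_sub_mul hq (x * v),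
    ← mul_assoc q x, ← mul_assoc q x]
  linear_combination qPoch (q * x * v) q * h1 - qPoch (q * x * u) q * h2

theorem saalDiff_eq_qFac_mul_saalDiff (hq : ‖q‖ < 1) (x : ℂ) (hu : u ≠ 0) (hv : v ≠ 0)
    (hαu : ∀ n : ℕ, α * (u * q ^ n) ≠ 1) (hβu : ∀ n : ℕ, β * (u * q ^ n) ≠ 1)
    (hαv : ∀ n : ℕ, α * (v * q ^ n) ≠ 1) (hβv : ∀ n : ℕ, β * (v * q ^ n) ≠ 1) (n : ℕ) :
    saalDiff q u v α β x =
      qFac (x * α * u * v) q n * qFac (x * β * u * v) q n * saalDiff q u v α β (x * q ^ n) := by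
  induction n with
  | zero => simp [qFac_zero]
  | succ n ih =>
    rw [ih, saalDiff_eq_mul_saalDiff hq _ hu hv hαu hβu hαv hβv, qFac_succ, qFac_succ]
    ring_nf

theorem saalDiff_eq_qPoch_mul_saalDiff_zero (hq : ‖q‖ < 1) (x : ℂ) (hu : u ≠ 0) (hv : v ≠ 0)
    (hαu : ∀ n : ℕ, α * (u * q ^ n) ≠ 1) (hβu : ∀ n : ℕ, β * (u * q ^ n) ≠ 1)
    (hαv : ∀ n : ℕ, α * (v * q ^ n) ≠ 1) (hβv : ∀ n : ℕ, β * (v * q ^ n) ≠ 1) :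
    saalDiff q u v α β x =
      qPoch (x * α * u * v) q * qPoch (x * β * u * v) q * saalDiff q u v α β 0 := by
  have h := ((tendsto_qFac hq (x * α * u * v)).mul (tendsto_qFac hq (x * β * u * v))).mul
    (tendsto_saalDiff_mul_pow hq u v α β x)
  exact tendsto_nhds_unique tendsto_const_nhds
    (h.congr fun n => (saalDiff_eq_qFac_mul_saalDiff hq x hu hv hαu hβu hαv hβv n).symm)

theorem saalDiff_inv (hq : ‖q‖ < 1) (hv : v ≠ 0) :
    saalDiff q u v α β v⁻¹ = -(v * qPoch q q * qPoch (q * v / u) q * qPoch (u / v) q *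
      qPoch (α * β * u * v) q / (qPoch (α * v) q * qPoch (β * v) q)) := by
  have h1 : qPoch (v⁻¹ * v) q = 0 := qPoch_eq_zero hq (n := 0) (by simp [hv])
  have h2 : ∀ n ≠ 0, saalTerm q v u α β v⁻¹ n = 0 := by
    intro n hn
    obtain ⟨k, rfl⟩ := Nat.exists_eq_succ_of_ne_zero hn
    rw [saalTerm, Nat.succ_eq_add_one, qFac_succ', inv_mul_cancel₀ hv]
    simp
  rw [saalDiff, h1, tsum_eq_single 0 h2, saalTerm, saalWeight, qFac_zero]
  simp only [pow_zero, mul_one]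
  rw [show q * v / v = q by field_simp, show α * β * v * u * v⁻¹ * v = α * β * u * v by field_simp,
    show v⁻¹ * u = u / v by ring]
  ring

theorem saalDiff_eq (hq : ‖q‖ < 1) (x : ℂ) (hu : u ≠ 0) (hv : v ≠ 0)
    (hαu : ∀ n : ℕ, α * (u * q ^ n) ≠ 1) (hβu : ∀ n : ℕ, β * (u * q ^ n) ≠ 1)
    (hαv : ∀ n : ℕ, α * (v * q ^ n) ≠ 1) (hβv : ∀ n : ℕ, β * (v * q ^ n) ≠ 1) :
    saalDiff q u v α β x = -(v * qPoch q q * qPoch (q * v / u) q * qPoch (u / v) q *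
      (qPoch (α * β * u * v) q * qPoch (x * α * u * v) q * qPoch (x * β * u * v) q) /
      (qPoch (α * u) q * qPoch (α * v) q * (qPoch (β * u) q * qPoch (β * v) q))) := by
  -- `x = v⁻¹` determines the constant, because one of the two series then has a single term.
  have h1 := saalDiff_eq_qPoch_mul_saalDiff_zero hq v⁻¹ hu hv hαu hβu hαv hβv
  rw [saalDiff_inv hq hv, show v⁻¹ * α * u * v = α * u by field_simp,
    show v⁻¹ * β * u * v = β * u by field_simp] at h1
  have hne : ∀ {c w : ℂ}, (∀ n : ℕ, c * (w * q ^ n) ≠ 1) → qPoch (c * w) q ≠ 0 := fun h =>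
    qPoch_ne_zero hq fun n => by rw [mul_assoc]; exact h n
  rw [saalDiff_eq_qPoch_mul_saalDiff_zero hq x hu hv hαu hβu hαv hβv,
    ← mul_div_cancel_left₀ (saalDiff q u v α β 0) (mul_ne_zero (hne hαu) (hne hβu)), ← h1]
  ring

end Saalschutz

end Saalschutz

section Integrand

open Filter Topology Finset

variable {q r : ℂ}

theorem prod_fin_three_of_ne {M : Type*} [CommMonoid M] (f : Fin 3 → M) {j k l : Fin 3}
    (hjk : j ≠ k) (hkl : k ≠ l) (hlj : l ≠ j) : ∏ i, f i = f j * f k * f l := by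
  have h : (univ : Finset (Fin 3)) = {j, k, l} := by
    revert j k l; decide
  rw [h, prod_insert (by simp [hjk, hlj.symm]), prod_insert (by simp [hkl]), prod_singleton,
    mul_assoc]

theorem sum_fin_three_of_ne {M : Type*} [AddCommMonoid M] (f : Fin 3 → M) {j k l : Fin 3}
    (hjk : j ≠ k) (hkl : k ≠ l) (hlj : l ≠ j) : ∑ i, f i = f j + f k + f l :=
  prod_fin_three_of_ne (M := Multiplicative M) f hjk hkl hlj

theorem fin_three_add_ne (j : Fin 3) : j ≠ j + 1 ∧ j + 1 ≠ j + 2 ∧ j + 2 ≠ j := by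
  decide +revert

theorem qPoch_ne_zero_of_ne_zpow (hq : ‖q‖ < 1) {x : ℂ} (hx : ∀ n : ℤ, x ≠ q ^ n) :
    qPoch x q ≠ 0 :=
  qPoch_ne_zero hq fun n h => hx (-n) (by
    rw [zpow_neg, zpow_natCast]
    exact eq_inv_of_mul_eq_one_left h)

theorem theta_ne_zero (hq : ‖q‖ < 1) (hq0 : q ≠ 0) {x : ℂ} (hx : ∀ n : ℤ, x ≠ q ^ n) :
    theta q x ≠ 0 := by
  refine mul_ne_zero (qPoch_ne_zero_of_ne_zpow hq hx) ?_
  refine qPoch_ne_zero_of_ne_zpow hq fun n h => hx (1 - n) ?_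
  have hx0 : x ≠ 0 := by
    rintro rfl
    exact zpow_ne_zero n hq0 (by rw [← h, div_zero])
  rw [zpow_sub₀ hq0, zpow_one, ← h]
  field_simp

theorem IsGeneric.shift {a b : Fin 3 → ℂ} (hq0 : q ≠ 0) (h : IsGeneric q a b) (M N : Fin 3 → ℤ) :
    IsGeneric q (fun i => q ^ M i * a i) (fun i => q ^ N i * b i) where
  mul_ne j k n hn := h.mul_ne j k (n - M j - N k) (by
    rw [zpow_sub₀ hq0, zpow_sub₀ hq0, ← hn]
    field_simp)
  left_ne j k n hjk hn := h.left_ne j k (n + M k - M j) hjk (by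
    rw [zpow_sub₀ hq0, zpow_add₀ hq0]
    field_simp
    linear_combination hn)
  right_ne j k n hjk hn := h.right_ne j k (n + N k - N j) hjk (by
    rw [zpow_sub₀ hq0, zpow_add₀ hq0]
    field_simp
    linear_combination hn)

section SaalSeries

variable {a b : Fin 3 → ℂ}

/-- The function whose values along the sequences `b_j q^n` are the terms of `saalSeries`. -/
def saalFun (q : ℂ) (a b : Fin 3 → ℂ) (z : ℂ) : ℂ :=
  z * ∏ i, qPoch (q * z / b i) q / qPoch (a i * z) q

/-- A nonterminating `₃φ₂` series with argument `q`, up to normalization; it is balanced when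
`a₀a₁a₂b₀b₁b₂ = q`. -/
def saalSeries (q : ℂ) (a b : Fin 3 → ℂ) (j : Fin 3) : ℂ := ∑' n : ℕ, saalFun q a b (b j * q ^ n)

theorem saalTerm_eq_qPoch_mul_saalFun (hq : ‖q‖ < 1) (hab : (∏ i, a i) * ∏ i, b i = q)
    (hb0 : ∀ i, b i ≠ 0) {j k l : Fin 3} (hjk : j ≠ k) (hkl : k ≠ l) (hlj : l ≠ j)
    (h0 : qPoch (a 0 * b j) q ≠ 0) (n : ℕ) :
    saalTerm q (b j) (b k) (a 1) (a 2) (a 0) n =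
      qPoch (a 0 * b j) q * saalFun q a b (b j * q ^ n) := by
  rw [prod_fin_three_of_ne b hjk hkl hlj, Fin.prod_univ_three] at hab
  have hbal : a 1 * a 2 * b j * b k * a 0 * (b j * q ^ n) = q * (b j * q ^ n) / b l := by
    rw [eq_div_iff (hb0 l)]
    linear_combination b j * q ^ n * hab
  rw [qPoch_eq_qFac_mul hq (a 0 * b j) n, mul_assoc (a 0)] at h0 ⊢
  rw [saalTerm, saalWeight, hbal, saalFun, prod_div_distrib, prod_fin_three_of_ne _ hjk hkl hlj,
    Fin.prod_univ_three]
  have hA := mul_inv_cancel₀ (right_ne_zero_of_mul h0)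
  generalize qPoch (a 0 * (b j * q ^ n)) q = A at *
  linear_combination -(b j * q ^ n * qFac (a 0 * b j) q n * (qPoch (q * (b j * q ^ n) / b j) q *
    qPoch (q * (b j * q ^ n) / b k) q * qPoch (q * (b j * q ^ n) / b l) q /
    (qPoch (a 1 * (b j * q ^ n)) q * qPoch (a 2 * (b j * q ^ n)) q))) * hA

theorem summable_saalFun (hq : ‖q‖ < 1) (hab : (∏ i, a i) * ∏ i, b i = q) (hb0 : ∀ i, b i ≠ 0)
    (j : Fin 3) (h0 : qPoch (a 0 * b j) q ≠ 0) :
    Summable fun n : ℕ => saalFun q a b (b j * q ^ n) := by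
  obtain ⟨k, l, hjk, hkl, hlj⟩ : ∃ k l : Fin 3, j ≠ k ∧ k ≠ l ∧ l ≠ j := by
    clear h0; decide +revert
  have h := summable_saalTerm hq (b j) (b k) (a 1) (a 2) (a 0)
  simp only [funext (saalTerm_eq_qPoch_mul_saalFun hq hab hb0 hjk hkl hlj h0)] at h
  exact (summable_mul_left_iff h0).1 h

/-- The nonterminating `q`-Saalschütz summation (Gasper–Rahman, (II.24)). -/
theorem saalSeries_sub (hq : ‖q‖ < 1) (hq0 : q ≠ 0) (hab : (∏ i, a i) * ∏ i, b i = q)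
    (h : IsGeneric q a b) {j k l : Fin 3} (hjk : j ≠ k) (hkl : k ≠ l) (hlj : l ≠ j) :
    saalSeries q a b j - saalSeries q a b k = -(b k * theta q (b j / b k) * qPoch q q *
      ∏ i, qPoch (q / (a i * b l)) q / (qPoch (a i * b j) q * qPoch (a i * b k) q)) := by
  have ha0 : ∀ i, a i ≠ 0 := fun i hi => hq0 (by
    rw [← hab, prod_eq_zero (mem_univ i) hi, zero_mul])
  have hb0 : ∀ i, b i ≠ 0 := fun i hi => hq0 (by
    rw [← hab, prod_eq_zero (mem_univ i) hi, mul_zero])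
  have hne : ∀ i j, qPoch (a i * b j) q ≠ 0 := fun i j =>
    qPoch_ne_zero_of_ne_zpow hq (h.mul_ne i j)
  have hne1 : ∀ i j (n : ℕ), a i * (b j * q ^ n) ≠ 1 := fun i j n hn => h.mul_ne i j (-n) (by
    rw [zpow_neg, zpow_natCast]
    exact eq_inv_of_mul_eq_one_left (by rw [← hn]; ring))
  have hsaal := saalDiff_eq hq (a 0) (hb0 j) (hb0 k) (hne1 1 j) (hne1 2 j) (hne1 1 k) (hne1 2 k)
  rw [prod_fin_three_of_ne b hjk hkl hlj, Fin.prod_univ_three] at hab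
  have hpair : ∀ i i' i'', a i * a i' * a i'' = a 0 * a 1 * a 2 →
      a i * a i' * b j * b k = q / (a i'' * b l) := fun i i' i'' hi => by
    rw [eq_div_iff (mul_ne_zero (ha0 _) (hb0 l)), ← hab, ← hi]; ring
  rw [hpair 1 2 0 (by ring), hpair 0 1 2 (by ring), hpair 0 2 1 (by ring)] at hsaal
  have hdiff : qPoch (a 0 * b j) q * qPoch (a 0 * b k) q *
      (saalSeries q a b j - saalSeries q a b k) =
        saalDiff q (b j) (b k) (a 1) (a 2) (a 0) := by
    rw [← prod_fin_three_of_ne b hjk hkl hlj, ← Fin.prod_univ_three a] at hab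
    simp only [saalDiff, saalSeries, tsum_mul_left,
      funext (saalTerm_eq_qPoch_mul_saalFun hq hab hb0 hjk hkl hlj (hne 0 j)),
      funext (saalTerm_eq_qPoch_mul_saalFun hq hab hb0 hjk.symm hlj.symm hkl.symm (hne 0 k))]
    ring
  rw [← mul_div_cancel_left₀ (saalSeries q a b j - saalSeries q a b k)
    (mul_ne_zero (hne 0 j) (hne 0 k)), hdiff, hsaal, Fin.prod_univ_three, theta,
    div_div_eq_mul_div]
  ring

/-- The theta function side of the nonterminating `q`-Saalschütz summation, see
`saalSeries_sub_add_one`. -/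
def saalTheta (q : ℂ) (a b : Fin 3 → ℂ) (j : Fin 3) : ℂ :=
  b (j + 1) * theta q (b j / b (j + 1)) * ∏ i, theta q (a i * b (j + 2))

theorem saalSeries_sub_add_one (hq : ‖q‖ < 1) (hq0 : q ≠ 0) (hab : (∏ i, a i) * ∏ i, b i = q)
    (h : IsGeneric q a b) (j : Fin 3) :
    saalSeries q a b j - saalSeries q a b (j + 1) =
      -(qPoch q q / ∏ i, ∏ j, qPoch (a i * b j) q) * saalTheta q a b j := by
  obtain ⟨hjk, hkl, hlj⟩ := fin_three_add_ne j
  have hprod : ∏ i, qPoch (q / (a i * b (j + 2))) q /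
        (qPoch (a i * b j) q * qPoch (a i * b (j + 1)) q) =
      (∏ i, theta q (a i * b (j + 2))) / ∏ i, ∏ j, qPoch (a i * b j) q := by
    rw [← prod_div_distrib]
    refine prod_congr rfl fun i _ => ?_
    rw [prod_fin_three_of_ne _ hjk hkl hlj, theta, mul_comm _ (qPoch (a i * b (j + 2)) q),
      mul_div_mul_left _ _ (qPoch_ne_zero_of_ne_zpow hq (h.mul_ne i (j + 2)))]
  rw [saalSeries_sub hq hq0 hab h hjk hkl hlj, hprod, saalTheta]
  ring

end SaalSeries

theorem exists_exp_eq_of_prod_eq {ι : Type*} [Fintype ι] [Nonempty ι] {a : ι → ℂ} {ρ : ℂ}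
    (ha : ∏ i, a i = Complex.exp ρ) :
    ∃ α : ι → ℂ, (∀ i, a i = Complex.exp (α i)) ∧ ∑ i, α i = ρ := by
  classical
  have h0 : ∀ i, a i ≠ 0 := fun i hi => Complex.exp_ne_zero ρ (by
    rw [← ha, prod_eq_zero (mem_univ i) hi])
  have hsum : Complex.exp (ρ - ∑ i, Complex.log (a i)) = 1 := by
    rw [Complex.exp_sub, Complex.exp_sum, ← ha]
    simp only [Complex.exp_log (h0 _)]
    exact div_self (prod_ne_zero_iff.2 fun i _ => h0 i)
  obtain ⟨i₀⟩ := ‹Nonempty ι›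
  refine ⟨(fun i => Complex.log (a i)) + Pi.single i₀ (ρ - ∑ i, Complex.log (a i)), fun i => ?_, ?_⟩
  · rw [Pi.add_apply, Complex.exp_add, Complex.exp_log (h0 i)]
    obtain rfl | hi := eq_or_ne i i₀
    · rw [Pi.single_eq_same, hsum, mul_one]
    · rw [Pi.single_eq_of_ne hi, Complex.exp_zero, mul_one]
  · simp [sum_add_distrib]

theorem prod_zpow_mul {ι G : Type*} [Fintype ι] [CommGroupWithZero G] {x : G} (hx : x ≠ 0)
    {M : ι → ℤ} (hM : ∑ i, M i = 0) (a : ι → G) : ∏ i, x ^ M i * a i = ∏ i, a i := by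
  have h : ∀ s : Finset ι, ∏ i ∈ s, x ^ M i = x ^ ∑ i ∈ s, M i := fun s => by
    classical
    induction s using Finset.induction_on with
    | empty => simp
    | insert i s hi ih => rw [prod_insert hi, sum_insert hi, zpow_add₀ hx, ih]
  rw [prod_mul_distrib, h, hM, zpow_zero, one_mul]

/-- The factor by which the differences of two of the series `saalSeries` change under the shifts
`a_i ↦ q^(M_i) a_i` and `b_i ↦ q^(N_i) b_i`. -/
def shiftFactor (r : ℂ) (a b : Fin 3 → ℂ) (M N : Fin 3 → ℤ) : ℂ :=
  r ^ (-∑ i, (M i ^ 2 + 2 * N i ^ 2)) * ∏ i, (a i ^ (-M i) * b i ^ (-2 * N i))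

section Shift

variable {a b : Fin 3 → ℂ} {M N : Fin 3 → ℤ}

-- With `r`, `-1` and the parameters written as exponentials, this and the next identity become
-- identities of quadratic polynomials modulo `2πi`.
theorem mul_prod_thetaFactor (hr0 : r ≠ 0) (hr : r ^ 2 = q) (ha : ∏ i, a i = r)
    (hb : ∏ i, b i = r) (hM : ∑ i, M i = 0) (hN : ∑ i, N i = 0) {j k l : Fin 3} (hjk : j ≠ k)
    (hkl : k ≠ l) (hlj : l ≠ j) :
    q ^ N k * b k * thetaFactor r (b j / b k) (N j - N k) *
      ∏ i, thetaFactor r (a i * b l) (M i + N l) = shiftFactor r a b M N * b k := by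
  obtain ⟨ρ, hρ⟩ : ∃ ρ, r = Complex.exp ρ := ⟨_, (Complex.exp_log hr0).symm⟩
  obtain ⟨α, hα, hαs⟩ := exists_exp_eq_of_prod_eq (ha.trans hρ)
  obtain ⟨β, hβ, hβs⟩ := exists_exp_eq_of_prod_eq (hb.trans hρ)
  rw [sum_fin_three_of_ne _ hjk hkl hlj] at hN hβs
  rw [Fin.sum_univ_three] at hM hαs
  rw [shiftFactor, prod_mul_distrib (f := fun i => a i ^ (-M i)),
    prod_fin_three_of_ne (fun i => b i ^ (-2 * N i)) hjk hkl hlj, sum_add_distrib,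
    sum_fin_three_of_ne (fun i => 2 * N i ^ 2) hjk hkl hlj]
  simp only [thetaFactor, Fin.prod_univ_three, Fin.sum_univ_three, ← hr, hρ, hα, hβ,
    ← Complex.exp_pi_mul_I]
  have hN' : N l = -N j - N k := by linear_combination hN
  have hM' : M 2 = -M 0 - M 1 := by linear_combination hM
  have hα' : α 2 = ρ - α 0 - α 1 := by linear_combination hαs
  have hβ' : β l = ρ - β j - β k := by linear_combination hβs
  rw [hN', hM', hα', hβ']
  simp only [← Complex.exp_int_mul, ← Complex.exp_nat_mul, ← Complex.exp_sub, ← Complex.exp_add]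
  rw [Complex.exp_eq_exp_iff_exists_int]
  refine ⟨-2 * N k - N j, ?_⟩
  push_cast
  ring

theorem prod_thetaFactor_mul_zpow (hr0 : r ≠ 0) (hr : r ^ 2 = q) (ha : ∏ i, a i = r)
    (hb : ∏ i, b i = r) (hN : ∑ i, N i = 0) (m : ℤ) (j : Fin 3) (s : ℕ) :
    (∏ i, thetaFactor r (a i * b j) (s - m + N j)) *
        ((-1) ^ m * (q ^ N j * r ^ (-m) * b j * q ^ s) ^ (-3 * m)) * b j ^ 2 =
      r ^ (∑ i, N i ^ 2) * (∏ i, b i ^ N i) * (b j * q ^ (s - m + N j)) * (q ^ N j * b j * q ^ s) *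
        ∏ i, thetaFactor r (b i / b j) (N i - N j - s) := by
  obtain ⟨k, l, hjk, hkl, hlj⟩ : ∃ k l : Fin 3, j ≠ k ∧ k ≠ l ∧ l ≠ j := by
    clear hr0 hr hN; decide +revert
  obtain ⟨ρ, hρ⟩ : ∃ ρ, r = Complex.exp ρ := ⟨_, (Complex.exp_log hr0).symm⟩
  obtain ⟨α, hα, hαs⟩ := exists_exp_eq_of_prod_eq (ha.trans hρ)
  obtain ⟨β, hβ, hβs⟩ := exists_exp_eq_of_prod_eq (hb.trans hρ)
  rw [sum_fin_three_of_ne _ hjk hkl hlj] at hN hβs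
  rw [Fin.sum_univ_three] at hαs
  rw [prod_fin_three_of_ne (fun i => b i ^ N i) hjk hkl hlj, sum_fin_three_of_ne _ hjk hkl hlj,
    prod_fin_three_of_ne (fun i => thetaFactor r (b i / b j) _) hjk hkl hlj]
  simp only [thetaFactor, Fin.prod_univ_three, ← hr, hρ, hα, hβ, ← Complex.exp_pi_mul_I]
  have hN' : N l = -N j - N k := by linear_combination hN
  have hα' : α 2 = ρ - α 0 - α 1 := by linear_combination hαs
  have hβ' : β l = ρ - β j - β k := by linear_combination hβs
  rw [hN', hα', hβ']
  simp only [← Complex.exp_int_mul, ← Complex.exp_nat_mul, ← Complex.exp_sub, ← Complex.exp_add]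
  rw [Complex.exp_eq_exp_iff_exists_int]
  refine ⟨3 * N j + 3 * s - m, ?_⟩
  push_cast
  ring

theorem saalTheta_shift (hq : ‖q‖ < 1) (hr0 : r ≠ 0) (hr : r ^ 2 = q) (ha : ∏ i, a i = r)
    (hb : ∏ i, b i = r) (hM : ∑ i, M i = 0) (hN : ∑ i, N i = 0) (j : Fin 3) :
    saalTheta q (fun i => q ^ M i * a i) (fun i => q ^ N i * b i) j =
      shiftFactor r a b M N * saalTheta q a b j := by
  have hq0 : q ≠ 0 := by rw [← hr]; positivity
  have ha0 : ∀ i, a i ≠ 0 := fun i hi => hr0 (by rw [← ha, prod_eq_zero (mem_univ i) hi])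
  have hb0 : ∀ i, b i ≠ 0 := fun i hi => hr0 (by rw [← hb, prod_eq_zero (mem_univ i) hi])
  obtain ⟨hjk, hkl, hlj⟩ := fin_three_add_ne j
  have hdiv : q ^ N j * b j / (q ^ N (j + 1) * b (j + 1)) =
      q ^ (N j - N (j + 1)) * (b j / b (j + 1)) := by
    rw [zpow_sub₀ hq0]; ring
  have hmul : ∀ i, q ^ M i * a i * (q ^ N (j + 2) * b (j + 2)) =
      q ^ (M i + N (j + 2)) * (a i * b (j + 2)) := fun i => by
    rw [zpow_add₀ hq0]; ring
  simp only [saalTheta, hdiv, hmul, theta_zpow_mul hq hr0 hr _ (div_ne_zero (hb0 _) (hb0 _)),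
    fun i l => theta_zpow_mul hq hr0 hr (M i + N l) (mul_ne_zero (ha0 i) (hb0 l)),
    prod_mul_distrib]
  linear_combination (theta q (b j / b (j + 1)) * ∏ i, theta q (a i * b (j + 2))) *
    mul_prod_thetaFactor hr0 hr ha hb hM hN hjk hkl hlj

end Shift

theorem qPoch_zpow_mul_ne_zero (hq : ‖q‖ < 1) (hq0 : q ≠ 0) {x : ℂ} (hx : ∀ n : ℤ, x ≠ q ^ n)
    (n : ℤ) : qPoch (q ^ n * x) q ≠ 0 :=
  qPoch_ne_zero_of_ne_zpow hq fun k h => hx (k - n) (by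
    rw [zpow_sub₀ hq0, ← h]
    field_simp)

theorem qFac_zpow_neg (hr0 : r ≠ 0) (hr : r ^ 2 = q) (s : ℕ) :
    qFac (q ^ (-s : ℤ)) q s = thetaFactor r 1 (-s) * qFac q q s := by
  have hq0 : q ≠ 0 := by rw [← hr]; positivity
  induction s with
  | zero => simp [qFac_zero, thetaFactor]
  | succ s ih =>
    have hs : thetaFactor r 1 (-s) = -(q ^ (s + 1)) * thetaFactor r 1 (-(s + 1 : ℕ)) := by
      have h := thetaFactor_add_one hr0 one_ne_zero (-(s + 1 : ℕ))
      rwa [Nat.cast_succ, neg_add, neg_add_cancel_right, hr, mul_one, ← neg_add, ← Nat.cast_succ,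
        zpow_neg, inv_inv, zpow_natCast] at h
    rw [qFac_succ', qFac_succ, show q * q ^ (-(s + 1 : ℕ) : ℤ) = q ^ (-s : ℤ) by
      rw [← zpow_one_add₀ hq0]; congr 1; push_cast; ring, ih, hs, zpow_neg, zpow_natCast]
    field_simp
    ring

section Kernel

variable {ι : Type*} [Fintype ι] [DecidableEq ι]

theorem prod_erase_qPoch_mul {b : ι → ℂ} {N : ι → ℤ} (hq : ‖q‖ < 1) (hr0 : r ≠ 0)
    (hr : r ^ 2 = q) (hb0 : ∀ i, b i ≠ 0) (j : ι)
    (hb : ∀ i ≠ j, ∀ n : ℤ, b j / b i ≠ q ^ n) (s : ℕ) :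
    (∏ i ∈ univ.erase j, qPoch (q ^ N i * b i / (q ^ N j * b j * q ^ s)) q) *
        (qFac (q ^ (-s : ℤ)) q s * qPoch q q) =
      (∏ i, thetaFactor r (b i / b j) (N i - N j - s)) * (∏ i ∈ univ.erase j, theta q (b i / b j)) *
        qPoch q q ^ 2 / ∏ i, qPoch (q * (q ^ N j * b j * q ^ s) / (q ^ N i * b i)) q := by
  have hq0 : q ≠ 0 := by rw [← hr]; positivity
  have hfac : ∀ i ∈ univ.erase j, qPoch (q ^ N i * b i / (q ^ N j * b j * q ^ s)) q =
      thetaFactor r (b i / b j) (N i - N j - s) * theta q (b i / b j) /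
        qPoch (q * (q ^ N j * b j * q ^ s) / (q ^ N i * b i)) q := by
    intro i hi
    have hne : qPoch (q * (q ^ N j * b j * q ^ s) / (q ^ N i * b i)) q ≠ 0 := by
      rw [show q * (q ^ N j * b j * q ^ s) / (q ^ N i * b i) =
        q ^ (1 + N j + s - N i) * (b j / b i) by
        rw [zpow_sub₀ hq0, zpow_add₀ hq0, zpow_add₀ hq0, zpow_natCast]; field_simp]
      exact qPoch_zpow_mul_ne_zero hq hq0 (hb i (ne_of_mem_erase hi)) _
    rw [← theta_zpow_mul hq hr0 hr _ (div_ne_zero (hb0 i) (hb0 j)), eq_div_iff hne,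
      show q ^ (N i - N j - s) * (b i / b j) = q ^ N i * b i / (q ^ N j * b j * q ^ s) by
        rw [zpow_sub₀ hq0, zpow_sub₀ hq0, zpow_natCast]; field_simp, theta, div_div_eq_mul_div]
  have hself :
      qPoch q q = qFac q q s * qPoch (q * (q ^ N j * b j * q ^ s) / (q ^ N j * b j)) q := by
    rw [qPoch_eq_qFac_mul hq q s]
    congr 2
    field_simp [hb0 j]
  have hne := right_ne_zero_of_mul (hself ▸ qPoch_self_ne_zero hq)
  rw [prod_congr rfl hfac, prod_div_distrib, prod_mul_distrib, qFac_zpow_neg hr0 hr,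
    ← mul_prod_erase univ (fun i => thetaFactor r (b i / b j) _) (mem_univ j),
    ← mul_prod_erase univ _ (mem_univ j), div_self (hb0 j), sub_self, zero_sub,
    mul_comm (qPoch _ q), ← div_div, eq_div_iff hne]
  generalize ∏ i ∈ univ.erase j, qPoch (q * (q ^ N j * b j * q ^ s) / (q ^ N i * b i)) q = P
  linear_combination -(thetaFactor r 1 (-s) *
    (∏ i ∈ univ.erase j, thetaFactor r (b i / b j) (N i - N j - s)) *
    (∏ i ∈ univ.erase j, theta q (b i / b j)) / P * qPoch q q) * hself

end Kernel

section ResidueSum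

variable {a b : Fin 3 → ℂ} {M N : Fin 3 → ℤ}

/-- The part of the residue `qKernelResidue_eq` that depends neither on `m` nor on the position in
the geometric sequence of poles. -/
def residueCoeff (q r : ℂ) (a b : Fin 3 → ℂ) (N : Fin 3 → ℤ) (j : Fin 3) : ℂ :=
  (∏ i, theta q (a i * b j)) / (b j ^ 2 * ∏ i ∈ univ.erase j, theta q (b i / b j)) *
    (r ^ (∑ i, N i ^ 2) * (∏ i, b i ^ N i) / qPoch q q ^ 2)

theorem IsGeneric.div_ne (h : IsGeneric q a b) (hb0 : ∀ i, b i ≠ 0) {i j : Fin 3} (hij : i ≠ j)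
    (n : ℤ) : b i / b j ≠ q ^ n :=
  fun hn => h.right_ne i j n hij (by rw [← hn, div_mul_cancel₀ _ (hb0 j)])

theorem mul_prod_qPoch_eq_saalFun (hq : ‖q‖ < 1) (hr0 : r ≠ 0) (hr : r ^ 2 = q)
    (ha0 : ∀ i, a i ≠ 0) (hb0 : ∀ i, b i ≠ 0) (h : IsGeneric q a b) (j : Fin 3) (n : ℤ) :
    b j * q ^ n * ∏ i, qPoch (q / (a i * (b j * q ^ n))) q * qPoch (q * (b j * q ^ n) / b i) q =
      (∏ i, thetaFactor r (a i * b j) n) * (∏ i, theta q (a i * b j)) *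
        saalFun q a b (b j * q ^ n) := by
  have hq0 : q ≠ 0 := by rw [← hr]; positivity
  rw [saalFun, mul_left_comm _ (b j * q ^ n), ← prod_mul_distrib, ← prod_mul_distrib]
  congr 1
  refine prod_congr rfl fun i _ => ?_
  have hne := qPoch_zpow_mul_ne_zero hq hq0 (h.mul_ne i j) n
  rw [← theta_zpow_mul hq hr0 hr n (mul_ne_zero (ha0 i) (hb0 j)), theta,
    show a i * (b j * q ^ n) = q ^ n * (a i * b j) by ring]
  generalize qPoch (q ^ n * (a i * b j)) q = x at hne ⊢
  field_simp

/-- The parameters `α` (and, for `b` and `-m`, the parameters `β`) for which `qKernel` is the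
`integrand`. -/
def numParam (q r : ℂ) (a : Fin 3 → ℂ) (m : ℤ) (i : Fin 3) : ℂ := q * r ^ m / a i

/-- The parameters `A` (and, for `b`, `N` and `-m`, the parameters `B`) for which `qKernel` is the
`integrand`. -/
def denParam (q r : ℂ) (a : Fin 3 → ℂ) (M : Fin 3 → ℤ) (m : ℤ) (i : Fin 3) : ℂ :=
  q ^ M i * r ^ m * a i

theorem qKernelResidue_eq_of_shift (hr0 : r ≠ 0) (hr : r ^ 2 = q) (m k : ℤ) (j : Fin 3) (s : ℕ) :
    qKernelResidue q (numParam q r a m) (numParam q r b (-m))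
        (denParam q r a M m) (denParam q r b N (-m)) k j s =
      (∏ i, qPoch (q / (a i * (b j * q ^ (s - m + N j)))) q *
          qPoch (q * (b j * q ^ (s - m + N j)) / b i) q) /
        ((∏ i, qPoch (q ^ M i * a i * (q ^ N j * b j * q ^ s)) q) *
          ((∏ i ∈ univ.erase j, qPoch (q ^ N i * b i / (q ^ N j * b j * q ^ s)) q) *
            (qFac (q ^ (-s : ℤ)) q s * qPoch q q))) *
        (q ^ N j * r ^ (-m) * b j * q ^ s) ^ k := by
  have hq0 : q ≠ 0 := by rw [← hr]; positivity
  have hrm : q ^ m = r ^ m * r ^ m := by rw [← hr, pow_two, mul_zpow]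
  have hy : q ^ N j * r ^ (-m) * b j * q ^ s = r ^ m * (b j * q ^ (s - m + N j)) := by
    rw [zpow_add₀ hq0, zpow_sub₀ hq0, zpow_natCast, zpow_neg, hrm]
    field_simp
  have hα : ∀ i, q * r ^ m / a i / (q ^ N j * r ^ (-m) * b j * q ^ s) =
      q / (a i * (b j * q ^ (s - m + N j))) := fun i => by
    rw [hy]; field_simp
  have hβ : ∀ i, q * r ^ (-m) / b i * (q ^ N j * r ^ (-m) * b j * q ^ s) =
      q * (b j * q ^ (s - m + N j)) / b i := fun i => by
    rw [hy, zpow_neg]; field_simp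
  have hA : ∀ i, q ^ M i * r ^ m * a i * (q ^ N j * r ^ (-m) * b j * q ^ s) =
      q ^ M i * a i * (q ^ N j * b j * q ^ s) := fun i => by
    rw [zpow_neg]; field_simp
  have hB : ∀ i, q ^ N i * r ^ (-m) * b i / (q ^ N j * r ^ (-m) * b j * q ^ s) =
      q ^ N i * b i / (q ^ N j * b j * q ^ s) := fun i => by
    field_simp
  simp only [qKernelResidue, numParam, denParam, hA, hB, hα, hβ]

theorem qKernelResidue_eq (hq : ‖q‖ < 1) (hr0 : r ≠ 0) (hr : r ^ 2 = q) (ha : ∏ i, a i = r)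
    (hb : ∏ i, b i = r) (hN : ∑ i, N i = 0) (h : IsGeneric q a b) (m : ℤ) (j : Fin 3) (s : ℕ) :
    (-1) ^ m * qKernelResidue q (numParam q r a m) (numParam q r b (-m))
        (denParam q r a M m) (denParam q r b N (-m)) (-3 * m) j s =
      residueCoeff q r a b N j * saalFun q a b (b j * q ^ (s - m + N j)) *
        saalFun q (fun i => q ^ M i * a i) (fun i => q ^ N i * b i) (q ^ N j * b j * q ^ s) := by
  have hq0 : q ≠ 0 := by rw [← hr]; positivity
  have ha0 : ∀ i, a i ≠ 0 := fun i hi => hr0 (by rw [← ha, prod_eq_zero (mem_univ i) hi])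
  have hb0 : ∀ i, b i ≠ 0 := fun i hi => hr0 (by rw [← hb, prod_eq_zero (mem_univ i) hi])
  have hnum := mul_prod_qPoch_eq_saalFun hq hr0 hr ha0 hb0 h j (s - m + N j)
  have hden := prod_erase_qPoch_mul (N := N) hq hr0 hr hb0 j
    (fun i hi => h.div_ne hb0 hi.symm) s
  have hmono := prod_thetaFactor_mul_zpow hr0 hr ha hb hN m j s
  have hy0 : b j * q ^ (s - m + N j) ≠ 0 := mul_ne_zero (hb0 j) (zpow_ne_zero _ hq0)
  have hμ0 : ∏ i, thetaFactor r (b i / b j) (N i - N j - s) ≠ 0 := prod_ne_zero_iff.2 fun i _ =>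
    thetaFactor_ne_zero hr0 (div_ne_zero (hb0 i) (hb0 j)) _
  rw [← eq_div_iff (pow_ne_zero 2 (hb0 j))] at hmono
  rw [mul_comm (b j * _), ← eq_div_iff hy0] at hnum
  rw [qKernelResidue_eq_of_shift hr0 hr, hnum, hden, residueCoeff,
    saalFun.eq_1 q (fun i => q ^ M i * a i), prod_div_distrib]
  generalize (q ^ N j * r ^ (-m) * b j * q ^ s) ^ (-3 * m) = p at *
  generalize b j * q ^ (s - m + N j) = y at *
  generalize q ^ N j * b j * q ^ s = w at *
  generalize ∏ i, thetaFactor r (b i / b j) (N i - N j - s) = μ at *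
  calc _ = (∏ i, thetaFactor r (a i * b j) (s - m + N j)) * ((-1) ^ m * p) *
      ((∏ i, theta q (a i * b j)) * saalFun q a b y * (∏ i, qPoch (q * w / (q ^ N i * b i)) q) /
        (y * (∏ i, qPoch (q ^ M i * a i * w) q) * μ *
          (∏ i ∈ univ.erase j, theta q (b i / b j)) * qPoch q q ^ 2)) := by
        simp only [div_eq_mul_inv, mul_inv, inv_inv]
        ring
    _ = _ := by
        rw [hmono]
        field_simp

theorem theta_div_symm (hq : ‖q‖ < 1) {x y : ℂ} (hx : x ≠ 0) (hy : y ≠ 0) :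
    x * theta q (y / x) = -(y * theta q (x / y)) := by
  rw [← inv_div, theta_inv hq (div_ne_zero hx hy)]
  field_simp

theorem prod_erase_fin_three {M : Type*} [CommMonoid M] (f : Fin 3 → M) {j k l : Fin 3}
    (hjk : j ≠ k) (hkl : k ≠ l) (hlj : l ≠ j) : ∏ i ∈ univ.erase j, f i = f k * f l := by
  have h : (univ : Finset (Fin 3)).erase j = {k, l} := by
    decide +revert
  rw [h, prod_insert (by simp [hkl]), prod_singleton]

theorem residueCoeff_mul_prod (hq : ‖q‖ < 1) (hq0 : q ≠ 0) (hb0 : ∀ i, b i ≠ 0)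
    (h : IsGeneric q a b) (j : Fin 3) :
    residueCoeff q r a b N j * ∏ i, b (i + 1) * theta q (b i / b (i + 1)) =
      -(r ^ (∑ i, N i ^ 2) * (∏ i, b i ^ N i) / qPoch q q ^ 2) * saalTheta q a b (j + 1) := by
  obtain ⟨hjk, hkl, hlj⟩ := fin_three_add_ne j
  have hne : ∀ {i k : Fin 3}, i ≠ k → theta q (b i / b k) ≠ 0 := fun hik =>
    theta_ne_zero hq hq0 (h.div_ne hb0 hik)
  obtain ⟨hj, hk, hl⟩ : j + 2 + 1 = j ∧ j + 1 + 1 = j + 2 ∧ j + 1 + 2 = j := by decide +revert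
  have hsymm : theta q (b (j + 1) / b j) = -(b (j + 1) * theta q (b j / b (j + 1))) / b j :=
    eq_div_of_mul_eq (hb0 j) (by rw [mul_comm, theta_div_symm hq (hb0 j) (hb0 _)])
  rw [residueCoeff, saalTheta, prod_erase_fin_three _ hjk hkl hlj,
    prod_fin_three_of_ne (fun i => b (i + 1) * _) hjk hkl hlj, hj, hk, hl, hsymm]
  have hj0 := hb0 j
  have hk0 := hb0 (j + 1)
  have hjk0 := hne hjk
  have hlj0 := hne hlj
  generalize ∏ i, theta q (a i * b j) = T
  field_simp

theorem sum_mul_mul_of_sub_eq {R : Type*} [CommRing R] {f g u : Fin 3 → R} {c d : R}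
    (hf : ∀ j, f j - f (j + 1) = c * u j) (hg : ∀ j, g j - g (j + 1) = d * u j)
    (hu : ∑ j, u j = 0) : ∑ j, u (j + 1) * (f j * g j) = -(c * d * ∏ j, u j) := by
  have hsucc (f : Fin 3 → R) : f (2 + 1) = f 0 := rfl
  have hf1 : f 1 = f 0 - c * u 0 := by rw [← hf 0, zero_add, sub_sub_cancel]
  have hf2 : f 2 = f 0 + c * u 2 := by rw [← hf 2, hsucc f, add_sub_cancel]
  have hg1 : g 1 = g 0 - d * u 0 := by rw [← hg 0, zero_add, sub_sub_cancel]
  have hg2 : g 2 = g 0 + d * u 2 := by rw [← hg 2, hsucc g, add_sub_cancel]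
  rw [Fin.sum_univ_three] at hu
  simp only [Fin.sum_univ_three, Fin.prod_univ_three, zero_add,
    show (1 + 1 : Fin 3) = 2 from rfl, hsucc, hf1, hf2, hg1, hg2]
  linear_combination (f 0 * g 0 + c * d * u 0 * u 2) * hu

theorem prod_qPoch_div_eq_theta (hq : ‖q‖ < 1) (hq0 : q ≠ 0) (h : IsGeneric q a b) :
    ∏ j, ∏ k, qPoch (q / (a j * b k)) q / qPoch (a j * b k * q ^ (M j + N k)) q =
      (∏ j, ∏ i, theta q (a i * b j)) / ((∏ i, ∏ j, qPoch (a i * b j) q) *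
        ∏ i, ∏ j, qPoch (q ^ M i * a i * (q ^ N j * b j)) q) := by
  rw [prod_comm (f := fun j i => theta q (a i * b j)), ← prod_mul_distrib, ← prod_div_distrib]
  refine prod_congr rfl fun i _ => ?_
  rw [← prod_mul_distrib, ← prod_div_distrib]
  refine prod_congr rfl fun j _ => ?_
  rw [theta, zpow_add₀ hq0, show a i * b j * (q ^ M i * q ^ N j) =
    q ^ M i * a i * (q ^ N j * b j) by ring,
    mul_div_mul_left _ _ (qPoch_ne_zero_of_ne_zpow hq (h.mul_ne i j))]

theorem two_mul_ring_choose_two (n : ℤ) : 2 * Ring.choose n 2 = n ^ 2 - n := by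
  have step : ∀ n : ℤ, Ring.choose (n + 1) 2 = n + Ring.choose n 2 := fun n => by
    rw [Ring.choose_succ_succ, Ring.choose_one_right]
  induction n using Int.induction_on with
  | zero => rw [Ring.choose_zero_succ]; rfl
  | succ n ih => rw [step]; linear_combination ih
  | pred n ih =>
    have h := step (-n - 1)
    rw [sub_add_cancel] at h
    linear_combination ih - 2 * h

theorem prod_zpow_choose_two (hq0 : q ≠ 0) (hr : r ^ 2 = q) (hM : ∑ i, M i = 0)
    (hN : ∑ i, N i = 0) : ∏ j, q ^ (Ring.choose (M j) 2 + Ring.choose (N j) 2) =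
      r ^ (∑ i, M i ^ 2 + ∑ i, N i ^ 2) := by
  rw [Fin.sum_univ_three] at hM hN
  rw [Fin.prod_univ_three, ← zpow_add₀ hq0, ← zpow_add₀ hq0, ← hr, ← zpow_natCast, ← zpow_mul]
  congr 1
  simp only [Fin.sum_univ_three, mul_add, Nat.cast_ofNat, two_mul_ring_choose_two]
  linear_combination -hM - hN

theorem shiftFactor_mul (hr0 : r ≠ 0) (hr : r ^ 2 = q) (hb0 : ∀ i, b i ≠ 0)
    (hM : ∑ i, M i = 0) (hN : ∑ i, N i = 0) :
    shiftFactor r a b M N * (r ^ (∑ i, N i ^ 2) * ∏ i, b i ^ N i) =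
      (∏ j, q ^ (Ring.choose (M j) 2 + Ring.choose (N j) 2) * a j ^ M j * b j ^ N j)⁻¹ := by
  have hq0 : q ≠ 0 := by rw [← hr]; positivity
  have hB : ∏ i, b i ^ N i ≠ 0 := prod_ne_zero_iff.2 fun i _ => zpow_ne_zero _ (hb0 i)
  have hr' : r ^ (∑ i, N i ^ 2) ≠ 0 := zpow_ne_zero _ hr0
  simp only [prod_mul_distrib, prod_zpow_choose_two hq0 hr hM hN, shiftFactor, sum_add_distrib,
    ← mul_sum, neg_mul, zpow_neg, prod_inv_distrib, zpow_add₀ hr0, zpow_mul', prod_pow, zpow_ofNat]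
  generalize r ^ (∑ i, N i ^ 2) = y at *
  field_simp

theorem sum_saalTheta (hq : ‖q‖ < 1) (hq0 : q ≠ 0) (hab : (∏ i, a i) * ∏ i, b i = q)
    (h : IsGeneric q a b) : ∑ j, saalTheta q a b j = 0 := by
  have hne : -(qPoch q q / ∏ i, ∏ j, qPoch (a i * b j) q) ≠ 0 :=
    neg_ne_zero.2 (div_ne_zero (qPoch_self_ne_zero hq) (prod_ne_zero_iff.2 fun i _ =>
      prod_ne_zero_iff.2 fun j _ => qPoch_ne_zero_of_ne_zpow hq (h.mul_ne i j)))
  have hshift : ∑ j, saalSeries q a b (j + 1) = ∑ j, saalSeries q a b j :=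
    Equiv.sum_comp (Equiv.addRight (1 : Fin 3)) (saalSeries q a b)
  refine (mul_eq_zero.1 ?_).resolve_left hne
  simp only [mul_sum, ← saalSeries_sub_add_one hq hq0 hab h, sum_sub_distrib, hshift, sub_self]

theorem sum_residueCoeff_mul (hq : ‖q‖ < 1) (hr0 : r ≠ 0) (hr : r ^ 2 = q) (ha : ∏ i, a i = r)
    (hb : ∏ i, b i = r) (hM : ∑ i, M i = 0) (hN : ∑ i, N i = 0) (h : IsGeneric q a b) :
    ∑ j, residueCoeff q r a b N j * (saalSeries q a b j *
        saalSeries q (fun i => q ^ M i * a i) (fun i => q ^ N i * b i) j) =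
      (∏ j, q ^ (Ring.choose (M j) 2 + Ring.choose (N j) 2) * a j ^ M j * b j ^ N j)⁻¹ *
        ∏ j, ∏ k, qPoch (q / (a j * b k)) q / qPoch (a j * b k * q ^ (M j + N k)) q := by
  have hq0 : q ≠ 0 := by rw [← hr]; positivity
  have hb0 : ∀ i, b i ≠ 0 := fun i hi => hr0 (by rw [← hb, prod_eq_zero (mem_univ i) hi])
  have hab : (∏ i, a i) * ∏ i, b i = q := by rw [ha, hb, ← pow_two, hr]
  have hab' : (∏ i, q ^ M i * a i) * ∏ i, q ^ N i * b i = q := by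
    rw [prod_zpow_mul hq0 hM, prod_zpow_mul hq0 hN, hab]
  have hf := saalSeries_sub_add_one hq hq0 hab h
  have hg := saalSeries_sub_add_one hq hq0 hab' (h.shift hq0 M N)
  simp only [saalTheta_shift hq hr0 hr ha hb hM hN, ← mul_assoc] at hg
  have hQ := qPoch_self_ne_zero hq
  have hX : ∏ i, b (i + 1) * theta q (b i / b (i + 1)) ≠ 0 := prod_ne_zero_iff.2 fun i _ =>
    mul_ne_zero (hb0 _) (theta_ne_zero hq hq0 (h.div_ne hb0 (fin_three_add_ne i).1))
  have hprod : ∏ j, saalTheta q a b j =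
      (∏ i, b (i + 1) * theta q (b i / b (i + 1))) * ∏ j, ∏ i, theta q (a i * b j) := by
    simp only [saalTheta, prod_mul_distrib]
    congr 1
    exact Equiv.prod_comp (Equiv.addRight (2 : Fin 3)) fun j => ∏ i, theta q (a i * b j)
  rw [← shiftFactor_mul hr0 hr hb0 hM hN, prod_qPoch_div_eq_theta hq hq0 h]
  have hcoeff : ∀ j, residueCoeff q r a b N j = _ := fun j =>
    eq_div_of_mul_eq hX (residueCoeff_mul_prod hq hq0 hb0 h j)
  have hsum := sum_mul_mul_of_sub_eq hf hg (sum_saalTheta hq hq0 hab h)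
  simp only [hcoeff, mul_div_right_comm, mul_assoc, ← mul_sum]
  rw [hsum, hprod]
  field_simp

end ResidueSum

theorem contourIntegral_const_mul (c : ℂ) (f : ℂ → ℂ) {x y : ℂ} (γ : Path x y) :
    contourIntegral (fun z => c * f z) γ = c * contourIntegral f γ := by
  simp only [contourIntegral_eq, mul_left_comm _ c, intervalIntegral.integral_const_mul]

theorem IsSeparatingContour.mono {x : ℂ} {γ : Path x x} {S T S' T' : Set ℂ}
    (h : IsSeparatingContour γ S T) (hS : S' ⊆ S) (hT : T' ⊆ T) : IsSeparatingContour γ S' T' where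
  piecewiseC1 := h.piecewiseC1
  inside w hw := h.inside w (Set.insert_subset_insert hS hw)
  outside w hw := h.outside w (hT hw)

theorem poleSeq_injective {ι : Type*} {B : ι → ℂ} (hq : ‖q‖ < 1) (hq0 : q ≠ 0)
    (hB0 : ∀ i, B i ≠ 0) (hB : ∀ i j (n : ℤ), i ≠ j → B i ≠ q ^ n * B j) :
    (poleSeq q B).Injective := by
  rintro ⟨i, s⟩ ⟨j, t⟩ h
  simp only [poleSeq] at h
  obtain rfl : i = j := by
    by_contra hij
    refine hB i j (t - s) hij ?_
    rw [zpow_sub₀ hq0, zpow_natCast, zpow_natCast, div_mul_eq_mul_div,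
      eq_div_iff (pow_ne_zero s hq0), h, mul_comm]
  have hst := congrArg norm (mul_left_cancel₀ (hB0 i) h)
  rw [norm_pow, norm_pow] at hst
  rw [pow_right_injective₀ (norm_pos_iff.2 hq0) hq.ne hst]

theorem IsGeneric.injective_qKernelPole {A B : Fin 3 → ℂ} (hq : ‖q‖ < 1) (hq0 : q ≠ 0)
    (h : IsGeneric q A B) (hA0 : ∀ i, A i ≠ 0) (hB0 : ∀ i, B i ≠ 0) :
    (qKernelPole q A B).Injective := by
  refine (poleSeq_injective hq hq0 hB0 h.right_ne).sumElim
    (inv_injective.comp (poleSeq_injective hq hq0 hA0 h.left_ne)) ?_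
  rintro ⟨j, s⟩ ⟨i, t⟩ heq
  refine h.mul_ne i j (-(t + s)) ?_
  have hA := mul_ne_zero (hA0 i) (pow_ne_zero t hq0)
  rw [poleSeq, poleSeq, ← mul_eq_one_iff_eq_inv₀ hA] at heq
  rw [zpow_neg, ← Nat.cast_add, zpow_natCast, ← mul_eq_one_iff_eq_inv₀ (pow_ne_zero _ hq0), pow_add]
  linear_combination heq

theorem IsGeneric.mul_const {a b : Fin 3 → ℂ} (h : IsGeneric q a b) {c : ℂ} (hc : c ≠ 0) :
    IsGeneric q (fun i => c * a i) (fun i => c⁻¹ * b i) where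
  mul_ne j k n hn := h.mul_ne j k n (by rw [← hn]; field_simp)
  left_ne j k n hjk hn := h.left_ne j k n hjk
    (mul_left_cancel₀ hc (by rw [hn, mul_left_comm]))
  right_ne j k n hjk hn := h.right_ne j k n hjk
    (mul_left_cancel₀ (inv_ne_zero hc) (by rw [hn, mul_left_comm]))

variable {a b : Fin 3 → ℂ} {M N : Fin 3 → ℤ}

theorem IsGeneric.denParam (hq0 : q ≠ 0) (hr0 : r ≠ 0) (h : IsGeneric q a b) (M N : Fin 3 → ℤ)
    (m : ℤ) : IsGeneric q (denParam q r a M m) (denParam q r b N (-m)) := by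
  convert (h.shift hq0 M N).mul_const (zpow_ne_zero m hr0) using 2 <;>
    simp only [SQED.denParam, zpow_neg] <;> ring

theorem denParam_ne_zero (hq0 : q ≠ 0) (hr0 : r ≠ 0) (ha0 : ∀ i, a i ≠ 0) (M : Fin 3 → ℤ) (m : ℤ)
    (i : Fin 3) : denParam q r a M m i ≠ 0 :=
  mul_ne_zero (mul_ne_zero (zpow_ne_zero _ hq0) (zpow_ne_zero _ hr0)) (ha0 i)

theorem integrand_eq_mul_qKernel (q r : ℂ) (a b : Fin 3 → ℂ) (M N : Fin 3 → ℤ) (m : ℤ) (z : ℂ) :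
    integrand q r a b M N m z =
      (-1) ^ m * qKernel q (numParam q r a m) (numParam q r b (-m))
        (denParam q r a M m) (denParam q r b N (-m)) (-3 * m) z := by
  simp only [integrand, qKernel, numParam, denParam, prod_div_distrib, prod_mul_distrib, div_div,
    div_mul_eq_mul_div]
  ring

theorem prod_numParam_div_denParam (hr0 : r ≠ 0) (hr : r ^ 2 = q) (ha : ∏ i, a i = r)
    (hb : ∏ i, b i = r) (hN : ∑ i, N i = 0) (m : ℤ) :
    (∏ i, numParam q r a m i / denParam q r b N (-m) i) * q ^ (-3 * m) = q ^ 2 := by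
  have hq0 : q ≠ 0 := by rw [← hr]; positivity
  have hrm : q ^ m = r ^ m * r ^ m := by rw [← hr, pow_two, mul_zpow]
  have hterm : ∀ i, numParam q r a m i / denParam q r b N (-m) i =
      q * q ^ m / (a i * (q ^ N i * b i)) := fun i => by
    rw [numParam, denParam, zpow_neg, hrm]
    field_simp
  simp only [hterm, prod_div_distrib, prod_mul_distrib (f := a), prod_zpow_mul hq0 hN, ha, hb,
    prod_const, card_univ, Fintype.card_fin, ← pow_two, hr]
  rw [neg_mul, mul_comm 3, zpow_neg, zpow_mul]
  have := zpow_ne_zero m hq0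
  simp only [zpow_ofNat]
  field_simp

theorem qPoch_mul_zpow_div_eq_zero (hq : ‖q‖ < 1) (hq0 : q ≠ 0) {c : ℂ} (hc : c ≠ 0) {n : ℤ}
    (hn : n < 0) : qPoch (q * (c * q ^ n) / c) q = 0 := by
  obtain ⟨k, rfl⟩ := Int.eq_negSucc_of_lt_zero hn
  refine qPoch_eq_zero hq (n := k) ?_
  rw [zpow_negSucc, pow_succ]
  field_simp

theorem qKernelResidue_eq_zero (hq : ‖q‖ < 1) (hr0 : r ≠ 0) (hr : r ^ 2 = q)
    (hb0 : ∀ i, b i ≠ 0) {m : ℤ} (k : ℤ) {j : Fin 3} {s : ℕ} (hs : s < m - N j) :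
    qKernelResidue q (numParam q r a m) (numParam q r b (-m))
      (denParam q r a M m) (denParam q r b N (-m)) k j s = 0 := by
  have hq0 : q ≠ 0 := by rw [← hr]; positivity
  have hzero := qPoch_mul_zpow_div_eq_zero hq hq0 (hb0 j) (show s - m + N j < 0 by lia)
  rw [qKernelResidue_eq_of_shift hr0 hr, prod_eq_zero (mem_univ j) (by rw [hzero, mul_zero])]
  simp

theorem qKernelInnerPoles_subset (hq : ‖q‖ < 1) (hr0 : r ≠ 0) (hr : r ^ 2 = q)
    (hb0 : ∀ i, b i ≠ 0) (m k : ℤ) :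
    qKernelInnerPoles q (numParam q r a m) (numParam q r b (-m))
      (denParam q r a M m) (denParam q r b N (-m)) k ⊆ polesToZero q r b N m := by
  have hq0 : q ≠ 0 := by rw [← hr]; positivity
  rintro _ ⟨⟨j, s⟩, hs, rfl⟩
  refine ⟨j, s, s.cast_nonneg, le_of_not_gt fun h =>
    hs (qKernelResidue_eq_zero hq hr0 hr hb0 k h), ?_⟩
  rw [poleSeq, denParam, zpow_add₀ hq0, zpow_natCast]
  ring

theorem qKernelOuterPoles_subset (hq : ‖q‖ < 1) (hr0 : r ≠ 0) (hr : r ^ 2 = q)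
    (ha0 : ∀ i, a i ≠ 0) (m k : ℤ) :
    qKernelOuterPoles q (numParam q r a m) (numParam q r b (-m))
      (denParam q r a M m) (denParam q r b N (-m)) k ⊆ polesToInfinity q r a M m := by
  intro z hz
  have hsub := qKernelInnerPoles_subset (a := b) (M := N) (N := M) hq hr0 hr ha0 (-m) (-k)
  rw [neg_neg] at hsub
  obtain ⟨j, s, hs0, hs, h⟩ := hsub hz
  exact ⟨j, s, hs0, hs, by rw [← inv_inv z, h, neg_neg]⟩

theorem contourIntegral_integrand_eq (hq : ‖q‖ < 1) (hr0 : r ≠ 0) (hr : r ^ 2 = q)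
    (ha : ∏ i, a i = r) (hb : ∏ i, b i = r) (hN : ∑ i, N i = 0) (h : IsGeneric q a b) {m : ℤ}
    {x : ℂ} {γ : Path x x}
    (hγ : IsSeparatingContour γ (polesToZero q r b N m) (polesToInfinity q r a M m)) {S : ℂ}
    (hS : HasSum (fun y : Fin 3 × ℕ => (-1) ^ m * qKernelResidue q (numParam q r a m)
      (numParam q r b (-m)) (denParam q r a M m) (denParam q r b N (-m)) (-3 * m) y.1 y.2) S) :
    contourIntegral (fun z => integrand q r a b M N m z / (2 * Real.pi * Complex.I * z)) γ = S := by
  have hq0 : q ≠ 0 := by rw [← hr]; positivity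
  have ha0 : ∀ i, a i ≠ 0 := fun i hi => hr0 (by rw [← ha, prod_eq_zero (mem_univ i) hi])
  have hb0 : ∀ i, b i ≠ 0 := fun i hi => hr0 (by rw [← hb, prod_eq_zero (mem_univ i) hi])
  have hp := (h.denParam hq0 hr0 M N m).injective_qKernelPole hq hq0
    (denParam_ne_zero hq0 hr0 ha0 M m) (denParam_ne_zero hq0 hr0 hb0 N (-m))
  have hk : ‖(∏ i, numParam q r a m i / denParam q r b N (-m) i) * q ^ (-3 * m)‖ < 1 := by
    rw [prod_numParam_div_denParam hr0 hr ha hb hN, norm_pow]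
    exact pow_lt_one₀ (norm_nonneg q) hq two_ne_zero
  have hsign : ((-1 : ℂ) ^ m) * (-1) ^ m = 1 := by rw [← mul_zpow]; simp
  have hS' : HasSum (fun y : Fin 3 × ℕ => qKernelResidue q (numParam q r a m)
      (numParam q r b (-m)) (denParam q r a M m) (denParam q r b N (-m)) (-3 * m) y.1 y.2)
      ((-1) ^ m * S) :=
    (hasSum_mul_left_iff (left_ne_zero_of_mul_eq_one hsign)).1
      (by rwa [← mul_assoc, hsign, one_mul])
  have hres := contourIntegral_qKernel_eq hq hq0 hp hk
    (hγ.mono (qKernelInnerPoles_subset hq hr0 hr hb0 m (-3 * m))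
      (qKernelOuterPoles_subset hq hr0 hr ha0 m (-3 * m))) hS'
  calc _ = contourIntegral (fun z => (-1) ^ m / (2 * Real.pi * Complex.I) *
        (qKernel q (numParam q r a m) (numParam q r b (-m)) (denParam q r a M m)
          (denParam q r b N (-m)) (-3 * m) z / z)) γ := by
        simp only [integrand_eq_mul_qKernel, mul_div_mul_comm]
    _ = (-1) ^ m / (2 * Real.pi * Complex.I) * (2 * Real.pi * Complex.I * ((-1) ^ m * S)) := by
        rw [contourIntegral_const_mul, hres]
    _ = S := by
        have := Complex.two_pi_I_ne_zero
        field_simp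
        rw [← pow_two] at hsign
        linear_combination S * hsign

section Summation

theorem saalFun_mul_zpow_eq_zero (hq : ‖q‖ < 1) (hq0 : q ≠ 0) (a : Fin 3 → ℂ) {j : Fin 3}
    (hb0 : b j ≠ 0) {n : ℤ} (hn : n < 0) : saalFun q a b (b j * q ^ n) = 0 := by
  rw [saalFun, prod_eq_zero (mem_univ j), mul_zero]
  rw [qPoch_mul_zpow_div_eq_zero hq hq0 hb0 hn, zero_div]

theorem hasSum_saalFun_int (hq : ‖q‖ < 1) (hq0 : q ≠ 0) (hab : (∏ i, a i) * ∏ i, b i = q)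
    (h : IsGeneric q a b) (j : Fin 3) :
    HasSum (fun n : ℤ => saalFun q a b (b j * q ^ n)) (saalSeries q a b j) := by
  have hb0 : ∀ i, b i ≠ 0 := fun i hi => hq0 (by
    rw [← hab, prod_eq_zero (mem_univ i) hi, mul_zero])
  have hsum := (summable_saalFun hq hab hb0 j
    (qPoch_ne_zero_of_ne_zpow hq (h.mul_ne 0 j))).hasSum
  refine (Function.Injective.hasSum_iff Nat.cast_injective fun n hn => ?_).1
    (by simpa [Function.comp_def, saalSeries] using hsum)
  refine saalFun_mul_zpow_eq_zero hq hq0 a (hb0 j) (lt_of_not_ge fun h0 => hn ⟨n.toNat, ?_⟩)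
  exact Int.toNat_of_nonneg h0

/-- The index change `(m, s) ↦ (s - m + N, s)`. -/
def shearEquiv (N : ℤ) : ℤ × ℕ ≃ ℤ × ℕ where
  toFun x := (x.2 - x.1 + N, x.2)
  invFun x := (x.2 - x.1 + N, x.2)
  left_inv x := Prod.ext (by ring) rfl
  right_inv x := Prod.ext (by ring) rfl

theorem hasSum_mul_shear {f : ℤ → ℂ} {g : ℕ → ℂ} {A B : ℂ} (hf : HasSum f A) (hg : HasSum g B)
    (N : ℤ) : HasSum (fun x : ℤ × ℕ => f (x.2 - x.1 + N) * g x.2) (A * B) :=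
  (shearEquiv N).hasSum_iff.2
    (hf.mul hg (summable_mul_of_summable_norm hf.summable.norm hg.summable.norm))

theorem hasSum_qKernelResidue (hq : ‖q‖ < 1) (hr0 : r ≠ 0) (hr : r ^ 2 = q) (ha : ∏ i, a i = r)
    (hb : ∏ i, b i = r) (hM : ∑ i, M i = 0) (hN : ∑ i, N i = 0) (h : IsGeneric q a b)
    (j : Fin 3) :
    HasSum (fun x : ℤ × ℕ => (-1) ^ x.1 * qKernelResidue q (numParam q r a x.1)
        (numParam q r b (-x.1)) (denParam q r a M x.1) (denParam q r b N (-x.1)) (-3 * x.1) j x.2)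
      (residueCoeff q r a b N j * (saalSeries q a b j *
        saalSeries q (fun i => q ^ M i * a i) (fun i => q ^ N i * b i) j)) := by
  have hq0 : q ≠ 0 := by rw [← hr]; positivity
  have hb0 : ∀ i, b i ≠ 0 := fun i hi => hr0 (by rw [← hb, prod_eq_zero (mem_univ i) hi])
  have hab : (∏ i, a i) * ∏ i, b i = q := by rw [ha, hb, ← pow_two, hr]
  have hshift := (summable_saalFun (a := fun i => q ^ M i * a i) (b := fun i => q ^ N i * b i) hq
    (by rw [prod_zpow_mul hq0 hM, prod_zpow_mul hq0 hN, hab])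
    (fun i => mul_ne_zero (zpow_ne_zero _ hq0) (hb0 i)) j
    (qPoch_ne_zero_of_ne_zpow hq ((h.shift hq0 M N).mul_ne 0 j))).hasSum
  simp only [qKernelResidue_eq hq hr0 hr ha hb hN h, mul_assoc (residueCoeff q r a b N j)]
  exact (hasSum_mul_shear (hasSum_saalFun_int hq hq0 hab h j) hshift (N j)).mul_left _

end Summation

end Integrand

end SQED

end

theorem theorem3 (q r : ℂ) (hq0 : q ≠ 0) (hq1 : ‖q‖ < 1) (hr : r ^ 2 = q)
    (a b : Fin 3 → ℂ) (M N : Fin 3 → ℤ)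
    (ha : ∏ j, a j = r) (hb : ∏ j, b j = r)
    (hM : ∑ j, M j = 0) (hN : ∑ j, N j = 0)
    (hgen : SQED.IsGeneric q a b)
    (x : ℤ → ℂ) (γ : ∀ m : ℤ, Path (x m) (x m))
    (hγ : ∀ m : ℤ, SQED.IsSeparatingContour (γ m)
      (SQED.polesToZero q r b N m) (SQED.polesToInfinity q r a M m)) :
    HasSum
      (fun m : ℤ => SQED.contourIntegral
        (fun z => SQED.integrand q r a b M N m z / (2 * Real.pi * Complex.I * z)) (γ m))
      ((∏ j, q ^ (Ring.choose (M j) 2 + Ring.choose (N j) 2) * a j ^ M j * b j ^ N j)⁻¹ *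
        ∏ j, ∏ k, SQED.qPoch (q / (a j * b k)) q /
          SQED.qPoch (a j * b k * q ^ (M j + N k)) q) := by
  have hr0 : r ≠ 0 := fun h => hq0 (by rw [← hr, h]; simp)
  have h := fun j => SQED.hasSum_qKernelResidue hq1 hr0 hr ha hb hM hN hgen j
  have hfib := fun m j => ((h j).summable.prod_factor m).hasSum
  rw [← SQED.sum_residueCoeff_mul hq1 hr0 hr ha hb hM hN hgen]
  convert hasSum_sum fun j _ => (h j).prod_fiberwise fun m => hfib m j using 2 with m
  exact SQED.contourIntegral_integrand_eq hq1 hr0 hr ha hb hN hgen (hγ m)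
    (SQED.hasSum_fintype_prod (hfib m))
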